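/- Let $\alpha\in(1/2,1)$ and $T>0$. Let $\pi:P\to M$ be a smooth principal fibre bundle over a connected, paracompact, finite-dimensional smooth manifold $M$, whose structure group $G$ is a (finite-dimensional) Lie group with Lie algebra $\mathfrak g$ acting on the right of $P$, and let $\omega$ be a connection form on $P$, i.e. a smooth $\mathfrak g$-valued $1$-form with $\omega\circ dR_g=\mathrm{Ad}(g^{-1})\,\omega$ for all $g\in G$ and $\omega(A^*)=A$ for all $A\in\mathfrak g$, where $A^*$ is the fundamental vector field of $A$. A path in a manifold is called $\alpha$-Hölder on an interval $J\subseteq[0,T]$ if it is continuous on $J$ and, in local charts, locally $\alpha$-Hölder on $J$ (on a compact interval this is the same as being $\alpha$-Hölder for the distance of any Riemannian metric). For an $\alpha$-Hölder path $y$ in $P$, the integral $\int_a^b\omega\,dy$ is the Young integral: $[a,b]$ is subdivided so that $y$ stays in one chart on each piece, and the Riemann–Stieltjes integrals $\sum_i\int\omega_i(y_s)\,dy^i_s$ in these charts are added. Let $x:[0,T]\to M$ be an $\alpha$-Hölder path and $u\in P$ with $\pi(u)=x_0$. For an interval $J\subseteq[0,T]$ containing $0$, a horizontal lift of $x$ on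 $J$ starting at $u$ is a path $\tilde x:J\to P$ that is $\alpha$-Hölder on $J$ and satisfies $\tilde x_0=u$, $\pi(\tilde x_t)=x_t$ for all $t\in J$, and $\int_0^t\omega\,d\tilde x_s=0$ for all $t\in J$ (the integral existing). **Theorem.** There exists, up to an explosion time, a unique horizontal lift of $x$ starting at $u$. Precisely, there are an interval $J$ and a horizontal lift $\tilde x$ of $x$ on $J$ starting at $u$ such that 1. either $J=[0,T]$, or $J=[0,\tau)$ for some $0<\tau\le T$ and $\tilde x$ explodes at $\tau$: for every compact $K\subseteq P$, $\tilde x_t\notin K$ for all $t<\tau$ sufficiently close to $\tau$; 2. if $\tilde x'$ is any horizontal lift of $x$ starting at $u$ on an interval $J'\subseteq[0,T]$ containing $0$, then $J'\subseteq J$ and $\tilde x'=\tilde x$ on $J'$. -/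

import Mathlib

open Set Filter Topology MulOpposite
open scoped Manifold ContDiff RightActions

namespace YoungLift

section Paths

variable {E : Type*} [NormedAddCommGroup E] [NormedSpace ℝ E]
  {F : Type*} [NormedAddCommGroup F] [NormedSpace ℝ F]
  {N : Type*} [TopologicalSpace N] [ChartedSpace E N]

/-- The path `x`, restricted to the time set `J`, is continuous and locally `α`-Hölder in the charts
of the manifold `N`. When `J` is a compact interval this says that `x` is `α`-Hölder on `J` (for the
distance of any Riemannian metric on `N`); when `J = [0, τ)` it says that `x` is `α`-Hölder on
`[0, t]` for every `t < τ`. -/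
def IsHolderPath (E : Type*) [NormedAddCommGroup E]
    {N : Type*} [TopologicalSpace N] [ChartedSpace E N] (α : ℝ) (J : Set ℝ) (x : ℝ → N) : Prop :=
  ContinuousOn x J ∧
    ∀ r ∈ J, ∃ C : ℝ, ∃ δ > 0, ∀ s ∈ J, ∀ t ∈ J, |s - r| < δ → |t - r| < δ →
      x s ∈ (chartAt E (x r)).source ∧ x t ∈ (chartAt E (x r)).source ∧
        ‖chartAt E (x r) (x t) - chartAt E (x r) (x s)‖ ≤ C * |t - s| ^ α

/-- For `a ≤ b`, the Riemann-Stieltjes integral `∫_a^b A(s) dy(s)` exists and equals `v`: the tagged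
sums `∑ A(ξ_i) (y(s_{i+1}) - y(s_i))`, `s_i ≤ ξ_i ≤ s_{i+1}`, over the partitions
`a = s_0 ≤ s_1 ≤ ... ≤ s_n = b` converge to `v` as the mesh tends to `0`. -/
def HasStieltjesIntegral (A : ℝ → E →L[ℝ] F) (y : ℝ → E) (a b : ℝ) (v : F) : Prop :=
  ∀ ε > 0, ∃ δ > 0, ∀ (n : ℕ) (s ξ : ℕ → ℝ), s 0 = a → s n = b →
    (∀ i < n, s i ≤ ξ i ∧ ξ i ≤ s (i + 1) ∧ s (i + 1) - s i < δ) →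
      ‖∑ i ∈ Finset.range n, A (ξ i) (y (s (i + 1)) - y (s i)) - v‖ < ε

/-- An `F`-valued 1-form `β` on `N` is smooth, i.e. it is a smooth function on the tangent bundle. -/
def IsSmoothOneForm [IsManifold 𝓘(ℝ, E) ∞ N] (β : ∀ p : N, TangentSpace 𝓘(ℝ, E) p →L[ℝ] F) :
    Prop :=
  ContMDiff 𝓘(ℝ, E).tangent 𝓘(ℝ, F) ∞ (fun v : TangentBundle 𝓘(ℝ, E) N ↦ β v.proj v.2)

/-- The expression of a 1-form `β` in the chart `e`: `∑ β_i dy^i`, at the coordinate point `z`. -/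
noncomputable def formInChart (e : OpenPartialHomeomorph N E)
    (β : ∀ p : N, TangentSpace 𝓘(ℝ, E) p →L[ℝ] F) (z : E) : E →L[ℝ] F :=
  (β (e.symm z)).comp (mfderiv 𝓘(ℝ, E) 𝓘(ℝ, E) e.symm z)

/-- The Young integral `∫_a^b β dx` of the 1-form `β` along the path `x` exists and equals `v`:
`[a, b]` is cut into finitely many intervals on each of which `x` stays in a chart, and `v` is the
sum of the Riemann-Stieltjes integrals `∑_i ∫ β_i(x) dx^i` in these charts. -/
def HasFormIntegral (β : ∀ p : N, TangentSpace 𝓘(ℝ, E) p →L[ℝ] F) (x : ℝ → N) (a b : ℝ) (v : F) :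
    Prop :=
  ∃ (n : ℕ) (t : ℕ → ℝ) (e : ℕ → OpenPartialHomeomorph N E) (w : ℕ → F),
    t 0 = a ∧ t n = b ∧ v = ∑ i ∈ Finset.range n, w i ∧
      ∀ i < n, t i ≤ t (i + 1) ∧ e i ∈ IsManifold.maximalAtlas 𝓘(ℝ, E) ∞ N ∧
        (∀ s ∈ Icc (t i) (t (i + 1)), x s ∈ (e i).source) ∧
        HasStieltjesIntegral (fun s ↦ formInChart (e i) β (e i (x s))) (fun s ↦ e i (x s))
          (t i) (t (i + 1)) (w i)

end Paths

section PrincipalBundle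

variable {EM : Type*} [NormedAddCommGroup EM] [NormedSpace ℝ EM]
  {M : Type*} [TopologicalSpace M] [ChartedSpace EM M]
  {EG : Type*} [NormedAddCommGroup EG] [NormedSpace ℝ EG]
  {G : Type*} [TopologicalSpace G] [ChartedSpace EG G] [Group G]
  {EP : Type*} [NormedAddCommGroup EP] [NormedSpace ℝ EP]
  {P : Type*} [TopologicalSpace P] [ChartedSpace EP P] [MulAction Gᵐᵒᵖ P]

/-- `π : P → M` is a smooth principal fibre bundle with structure group `G`, which acts on the right
of `P` by `(p, g) ↦ p <• g`: the action is smooth and free, its orbits are the fibres of the smooth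
surjection `π`, and `P` is locally `G`-equivariantly diffeomorphic to `U × G` over `U ⊆ M`. -/
structure IsPrincipalBundle (EM EG EP G : Type*) [NormedAddCommGroup EM] [NormedSpace ℝ EM]
    {M : Type*} [TopologicalSpace M] [ChartedSpace EM M]
    [NormedAddCommGroup EG] [NormedSpace ℝ EG]
    [TopologicalSpace G] [ChartedSpace EG G] [Group G]
    [NormedAddCommGroup EP] [NormedSpace ℝ EP]
    {P : Type*} [TopologicalSpace P] [ChartedSpace EP P] [MulAction Gᵐᵒᵖ P] (π : P → M) : Prop where
  contMDiff_act : ContMDiff (𝓘(ℝ, EP).prod 𝓘(ℝ, EG)) 𝓘(ℝ, EP) ∞ (fun q : P × G ↦ q.1 <• q.2)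
  contMDiff_proj : ContMDiff 𝓘(ℝ, EP) 𝓘(ℝ, EM) ∞ π
  surjective_proj : Function.Surjective π
  free : ∀ (p : P) (g : G), p <• g = p → g = 1
  fibre : ∀ p q : P, π p = π q ↔ ∃ g : G, q = p <• g
  locallyTrivial : ∀ m : M, ∃ (U : Set M) (φ : OpenPartialHomeomorph P (M × G)),
    IsOpen U ∧ m ∈ U ∧ φ.source = π ⁻¹' U ∧ φ.target = U ×ˢ univ ∧
    ContMDiffOn 𝓘(ℝ, EP) (𝓘(ℝ, EM).prod 𝓘(ℝ, EG)) ∞ φ φ.source ∧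
    ContMDiffOn (𝓘(ℝ, EM).prod 𝓘(ℝ, EG)) 𝓘(ℝ, EP) ∞ φ.symm φ.target ∧
    ∀ p ∈ φ.source, (φ p).1 = π p ∧ ∀ g : G, (φ (p <• g)).2 = (φ p).2 * g

/-- The fundamental vector field `A^*` of `A` in the Lie algebra of `G`: at `p` it is the derivative
at the identity of `g ↦ p g` in the direction `A`, i.e. the velocity at `0` of `p exp(tA)`. -/
noncomputable def fundamentalField (A : GroupLieAlgebra 𝓘(ℝ, EG) G) (p : P) :
    TangentSpace 𝓘(ℝ, EP) p :=
  (mfderiv 𝓘(ℝ, EG) 𝓘(ℝ, EP) (fun g : G ↦ p <• g) 1 A : EP)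

/-- The adjoint action of `g` on the Lie algebra: the derivative at `1` of `a ↦ g a g⁻¹`. -/
noncomputable def Ad (g : G) (A : GroupLieAlgebra 𝓘(ℝ, EG) G) : GroupLieAlgebra 𝓘(ℝ, EG) G :=
  (mfderiv 𝓘(ℝ, EG) 𝓘(ℝ, EG) (fun a : G ↦ g * a * g⁻¹) 1 A : EG)

/-- `η` is a connection form: a smooth 1-form on `P` with values in the Lie algebra of `G`, such
that `η ∘ dR_g = Ad(g⁻¹) η` and `η(A^*) = A`. -/
structure IsConnectionForm [IsManifold 𝓘(ℝ, EP) ∞ P]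
    (η : ∀ p : P, TangentSpace 𝓘(ℝ, EP) p →L[ℝ] GroupLieAlgebra 𝓘(ℝ, EG) G) : Prop where
  smooth : IsSmoothOneForm (F := EG) η
  equivariant : ∀ (p : P) (g : G) (v : TangentSpace 𝓘(ℝ, EP) p),
    η (p <• g) (mfderiv 𝓘(ℝ, EP) 𝓘(ℝ, EP) (fun q : P ↦ q <• g) p v) = Ad g⁻¹ (η p v)
  vertical : ∀ (A : GroupLieAlgebra 𝓘(ℝ, EG) G) (p : P), η p (fundamentalField A p) = A

/-- `y` is, on the time interval `J ∋ 0`, a horizontal lift of the path `x` starting at `u`. -/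
structure IsHorizontalLift (π : P → M)
    (η : ∀ p : P, TangentSpace 𝓘(ℝ, EP) p →L[ℝ] GroupLieAlgebra 𝓘(ℝ, EG) G)
    (α : ℝ) (x : ℝ → M) (u : P) (J : Set ℝ) (y : ℝ → P) : Prop where
  holder : IsHolderPath EP α J y
  init : y 0 = u
  proj : ∀ t ∈ J, π (y t) = x t
  horizontal : ∀ t ∈ J, HasFormIntegral (F := EG) η y 0 t 0

end PrincipalBundle

end YoungLift

/-!
The integral condition on a lift is first made local. A path `y` that is Hölder of exponent
`α > 1 / 2` is horizontal if and only if, in charts, `η(y_s) (y_t - y_s)` is of order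
`|t - s| ^ (2 * α)` near every time. Here `2 * α > 1` enters through two facts: increments of order
`2 * α` are those of a constant (`eq_of_nearO`), and Riemann sums do not see terms of that order
(`hasStieltjesIntegral_of_nearO`). The local condition does not depend on the chart, because by
Taylor's formula a change of charts is linear up to terms of second order in the increments. A
*primitive* of a form `β` along `y` is a function `I` of time with
`I_t - I_s = β(y_s) (y_t - y_s)` up to order `2 * α`. Primitives exist (`exists_isPrimitiveAt`), the
integral of `β` is the increment of any primitive (`HasFormIntegral.eq_sub`), and so all integrals of
`η` along `y` vanish exactly when `0` is a primitive (`forall_hasFormIntegral_zero_iff`).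

At each point `p` the pair `(dπ, η)` is an isomorphism from `T_p P` to the product of `T_{π p} M` and
the Lie algebra (`IsConnectionForm.bijective`): differentiating a local trivialization shows that `π`
is a submersion whose vertical vectors are the fundamental ones, and on these `η` is the inverse of
`A ↦ A^*`. Inverting the isomorphism gives the horizontal lift `h` of tangent vectors, which is smooth
in charts. Hence the lifts of `x` are, in charts, the solutions of the Young equation `dY = h(Y) dX`,
in the sense that `Y_t - Y_s = h(Y_s) (X_t - X_s)` up to order `2 * α`.

Solutions of this equation are limits of Euler schemes along an ultrafilter
(`exists_young_solution`); the estimate that passes to the limit, `euler_scheme_bound`, is proved by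
bisecting the time interval, each bisection gaining the factor `2 ^ (1 - 2 * α) < 1`. The same gain
gives local uniqueness (`young_solution_eventually_eq`). Since local existence is uniform in the
initial time and the initial point, a lift that does not leave all compact sets accumulates at some
point of `P` and can be continued (`IsYoungLift.exists_extension`). The lift on the set of all times
up to which lifts exist therefore has the required properties.
-/

namespace YoungLift

/-! ### Euler schemes for Young equations -/

section Euler

/-- Discrete intermediate value: a sequence that starts below `c` and ends above `c` crosses `c`. -/
theorem exists_crossing (t : ℕ → ℝ) (c : ℝ) (m : ℕ) (hm : m ≠ 0) (h0 : t 0 ≤ c) (hc : c ≤ t m) :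
    ∃ j < m, t j ≤ c ∧ c ≤ t (j + 1) := by
  induction m with
  | zero => exact absurd rfl hm
  | succ m ih =>
    rcases le_or_gt (t m) c with h | h
    · exact ⟨m, m.lt_succ_self, h, hc⟩
    · have hm' : m ≠ 0 := by
        rintro rfl
        exact absurd h0 (not_le.2 h)
      obtain ⟨j, hj, h1, h2⟩ := ih hm' h.le
      exact ⟨j, hj.trans m.lt_succ_self, h1, h2⟩

/-- Halving an interval gains the factor `2 ^ (1 - 2 * α) < 1` on two copies of `|·| ^ (2 * α)`. -/
theorem two_mul_half_rpow {d α : ℝ} (hd : 0 ≤ d) :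
    2 * (d / 2) ^ (2 * α) = 2 ^ (1 - 2 * α) * d ^ (2 * α) := by
  rw [Real.div_rpow hd (by norm_num), Real.rpow_sub (by norm_num), Real.rpow_one]
  ring

theorem rpow_two_mul_eq {d α : ℝ} (hd : 0 ≤ d) : d ^ (2 * α) = d ^ α * d ^ α := by
  rw [mul_comm, Real.rpow_mul hd]
  norm_num [pow_two]

variable {E V : Type*} [NormedAddCommGroup E] [NormedSpace ℝ E]
  [NormedAddCommGroup V] [NormedSpace ℝ V]

/-- The Euler scheme of `dz = h(t, z) dX` on a time grid is a solution up to an error of order `2α`,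
with a constant that does not depend on the grid. The grid is split at the middle of the time
interval, and the error of the two halves is bounded inductively. -/
theorem euler_scheme_bound {α B H L₁ L₂ K a b : ℝ} (hα : 0 < α) (hH : 0 ≤ H)
    (hB0 : 0 ≤ B) (hL₁ : 0 ≤ L₁) (hL₂ : 0 ≤ L₂) (hK0 : 0 ≤ K) {X : ℝ → V} {h : ℝ → E → V →L[ℝ] E}
    (hX : ∀ s ∈ Icc a b, ∀ t ∈ Icc a b, ‖X t - X s‖ ≤ H * |t - s| ^ α)
    (hB : ∀ s ∈ Icc a b, ∀ z, ‖h s z‖ ≤ B)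
    (hL : ∀ s ∈ Icc a b, ∀ t ∈ Icc a b, ∀ z z', ‖h t z' - h s z‖ ≤ L₁ * |t - s| ^ α + L₂ * ‖z' - z‖)
    (hK : 2 * H * (L₁ + L₂ * (2 * B * H + K * (b - a) ^ α)) + 2 ^ (1 - 2 * α) * K ≤ K)
    {t : ℕ → ℝ} (ht : Monotone t) (htm : ∀ k, t k ∈ Icc a b) {z : ℕ → E}
    (hz : ∀ k, z (k + 1) = z k + h (t k) (z k) (X (t (k + 1)) - X (t k))) (m k : ℕ) :
    ‖z (k + m) - z k - h (t k) (z k) (X (t (k + m)) - X (t k))‖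
      ≤ K * (t (k + m) - t k) ^ (2 * α) := by
  induction m using Nat.strong_induction_on generalizing k with
  | _ m ih =>
    rcases eq_or_ne m 0 with rfl | hm
    · simp only [add_zero, sub_self, map_zero, norm_zero]
      positivity
    set D := t (k + m) - t k with hD
    have hD0 : 0 ≤ D := sub_nonneg.2 (ht (Nat.le_add_right _ _))
    obtain ⟨j, hjm, hj1, hj2⟩ := exists_crossing (fun i => t (k + i)) (t k + D / 2) m hm
      (by rw [add_zero]; linarith) (by linarith)
    have ih1 := ih j hjm k
    have ih2 := ih (m - j - 1) (by omega) (k + j + 1)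
    have e1 : k + j + 1 + (m - j - 1) = k + m := by omega
    rw [e1] at ih2
    rw [← add_assoc] at hj2
    have m1 : t k ≤ t (k + j) := ht (Nat.le_add_right _ _)
    have m2 : t (k + j) ≤ t (k + j + 1) := ht (Nat.le_succ _)
    have m3 : t (k + j + 1) ≤ t (k + m) := ht (by omega)
    have a1 : (t (k + j) - t k) ^ (2 * α) ≤ (D / 2) ^ (2 * α) :=
      Real.rpow_le_rpow (by linarith) (by linarith) (by linarith)
    have a2 : (t (k + m) - t (k + j + 1)) ^ (2 * α) ≤ (D / 2) ^ (2 * α) :=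
      Real.rpow_le_rpow (by linarith) (by linarith) (by linarith)
    have incr : ∀ p q, t k ≤ t p → t p ≤ t q → t q ≤ t (k + m) → |t q - t p| ^ α ≤ D ^ α := by
      intro p q h1 h2 h3
      rw [abs_of_nonneg (by linarith)]
      exact Real.rpow_le_rpow (by linarith) (by linarith) hα.le
    have Xincr : ∀ p q, t k ≤ t p → t p ≤ t q → t q ≤ t (k + m) →
        ‖X (t q) - X (t p)‖ ≤ H * D ^ α := fun p q h1 h2 h3 =>
      (hX _ (htm p) _ (htm q)).trans (mul_le_mul_of_nonneg_left (incr p q h1 h2 h3) hH)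
    have hDb : D ^ α ≤ (b - a) ^ α :=
      Real.rpow_le_rpow hD0 (by linarith [(htm (k + m)).2, (htm k).1]) hα.le
    have hDα : 0 ≤ D ^ α := by positivity
    have step : ∀ p v, ‖h (t p) (z p) v‖ ≤ B * ‖v‖ := fun p v =>
      (ContinuousLinearMap.le_opNorm _ _).trans (by gcongr; exact hB _ (htm p) _)
    have zj : ‖z (k + j) - z k‖ ≤ (B * H + K * (b - a) ^ α) * D ^ α := by
      have : z (k + j) - z k = (z (k + j) - z k - h (t k) (z k) (X (t (k + j)) - X (t k)))
          + h (t k) (z k) (X (t (k + j)) - X (t k)) := by abel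
      rw [this]
      refine (norm_add_le _ _).trans ?_
      have b1 : K * (t (k + j) - t k) ^ (2 * α) ≤ K * (b - a) ^ α * D ^ α := by
        have : (D / 2) ^ (2 * α) ≤ D ^ (2 * α) :=
          Real.rpow_le_rpow (by linarith) (by linarith) (by linarith)
        rw [rpow_two_mul_eq hD0] at this
        have h' : D ^ α * D ^ α ≤ (b - a) ^ α * D ^ α := by gcongr
        rw [mul_assoc]
        gcongr
        linarith
      have b2 := (step k (X (t (k + j)) - X (t k))).trans
        (mul_le_mul_of_nonneg_left (Xincr k (k + j) le_rfl m1 (by linarith)) hB0)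
      linarith
    have zj1 : ‖z (k + j + 1) - z k‖ ≤ (2 * B * H + K * (b - a) ^ α) * D ^ α := by
      have : z (k + j + 1) - z k
          = h (t (k + j)) (z (k + j)) (X (t (k + j + 1)) - X (t (k + j))) + (z (k + j) - z k) := by
        rw [hz]; abel
      rw [this]
      refine (norm_add_le _ _).trans ?_
      have b2 := (step (k + j) (X (t (k + j + 1)) - X (t (k + j)))).trans
        (mul_le_mul_of_nonneg_left (Xincr (k + j) (k + j + 1) m1 m2 m3) hB0)
      linarith
    have dh : ∀ p, t k ≤ t p → t p ≤ t (k + m) →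
        ‖z p - z k‖ ≤ (2 * B * H + K * (b - a) ^ α) * D ^ α →
        ‖h (t p) (z p) - h (t k) (z k)‖
          ≤ (L₁ + L₂ * (2 * B * H + K * (b - a) ^ α)) * D ^ α := by
      intro p h1 h2 h3
      refine (hL _ (htm k) _ (htm p) _ _).trans ?_
      have := mul_le_mul_of_nonneg_left h3 hL₂
      have := mul_le_mul_of_nonneg_left (incr k p le_rfl h1 h2) hL₁
      linarith
    have c1 : ‖(h (t (k + j)) (z (k + j)) - h (t k) (z k)) (X (t (k + j + 1)) - X (t (k + j)))‖
        ≤ (L₁ + L₂ * (2 * B * H + K * (b - a) ^ α)) * D ^ α * (H * D ^ α) := by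
      refine (ContinuousLinearMap.le_opNorm _ _).trans (mul_le_mul (dh (k + j) m1 (by linarith) ?_)
        (Xincr _ _ m1 m2 m3) (norm_nonneg _) ((norm_nonneg _).trans (dh (k + j) m1 (by linarith) ?_)))
      all_goals
        refine zj.trans ?_
        gcongr
        linarith [mul_nonneg hB0 hH]
    have c2 : ‖(h (t (k + j + 1)) (z (k + j + 1)) - h (t k) (z k))
          (X (t (k + m)) - X (t (k + j + 1)))‖
        ≤ (L₁ + L₂ * (2 * B * H + K * (b - a) ^ α)) * D ^ α * (H * D ^ α) :=
      (ContinuousLinearMap.le_opNorm _ _).trans (mul_le_mul (dh _ (m1.trans m2) m3 zj1)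
        (Xincr _ _ (m1.trans m2) m3 le_rfl) (norm_nonneg _)
        ((norm_nonneg _).trans (dh _ (m1.trans m2) m3 zj1)))
    have key : z (k + m) - z k - h (t k) (z k) (X (t (k + m)) - X (t k))
        = (z (k + j) - z k - h (t k) (z k) (X (t (k + j)) - X (t k)))
          + (z (k + m) - z (k + j + 1) - h (t (k + j + 1)) (z (k + j + 1))
            (X (t (k + m)) - X (t (k + j + 1))))
          + (h (t (k + j)) (z (k + j)) - h (t k) (z k)) (X (t (k + j + 1)) - X (t (k + j)))
          + (h (t (k + j + 1)) (z (k + j + 1)) - h (t k) (z k))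
            (X (t (k + m)) - X (t (k + j + 1))) := by
      rw [hz (k + j)]
      simp only [map_sub, _root_.sub_apply]
      abel
    rw [key]
    refine (norm_add_le_of_le (norm_add_le_of_le (norm_add_le_of_le
      (ih1.trans (mul_le_mul_of_nonneg_left a1 hK0)) (ih2.trans (mul_le_mul_of_nonneg_left a2 hK0)))
      c1) c2).trans ?_
    have e2 := two_mul_half_rpow (α := α) hD0
    have e3 := rpow_two_mul_eq (α := α) hD0
    have e4 := mul_le_mul_of_nonneg_right hK (mul_nonneg hDα hDα)
    have e5 : K * (2 * (D / 2) ^ (2 * α)) = K * (2 ^ (1 - 2 * α) * D ^ (2 * α)) := by rw [e2]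
    rw [e3] at e5 ⊢
    linarith

/-- Existence for the Young equation `dY = h(t, Y) dX` in the sense of Davie: the increments of `Y`
agree with those of `h(s, Y_s) X` up to order `2α > 1`. The solution is a limit of Euler schemes along
an ultrafilter; boundedness and finite dimension give the limit, and the uniform bound of the Euler
schemes passes to it. -/
theorem exists_young_solution [FiniteDimensional ℝ E] {α B H L₁ L₂ K a b : ℝ} (hα : 0 < α)
    (hab : a ≤ b) (hH : 0 ≤ H) (hB0 : 0 ≤ B) (hL₁ : 0 ≤ L₁) (hL₂ : 0 ≤ L₂) (hK0 : 0 ≤ K)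
    {X : ℝ → V} {h : ℝ → E → V →L[ℝ] E}
    (hX : ∀ s ∈ Icc a b, ∀ t ∈ Icc a b, ‖X t - X s‖ ≤ H * |t - s| ^ α)
    (hB : ∀ s ∈ Icc a b, ∀ z, ‖h s z‖ ≤ B)
    (hL : ∀ s ∈ Icc a b, ∀ t ∈ Icc a b, ∀ z z', ‖h t z' - h s z‖ ≤ L₁ * |t - s| ^ α + L₂ * ‖z' - z‖)
    (hK : 2 * H * (L₁ + L₂ * (2 * B * H + K * (b - a) ^ α)) + 2 ^ (1 - 2 * α) * K ≤ K) (q : E) :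
    ∃ Y : ℝ → E, Y a = q ∧ ∀ s ∈ Icc a b, ∀ t ∈ Icc a b, s ≤ t →
      ‖Y t - Y s - h s (Y s) (X t - X s)‖ ≤ K * (t - s) ^ (2 * α) := by
  -- the grid of step `1 / (N + 1)`, stopped at `b`
  let g : ℕ → ℕ → ℝ := fun N k => min b (a + k / (N + 1))
  have gmono : ∀ N, Monotone (g N) := fun N k l hkl => by
    simp only [g]
    gcongr
  have gmem : ∀ N k, g N k ∈ Icc a b := fun N k =>
    ⟨le_min hab (le_add_of_nonneg_right (by positivity)), min_le_left _ _⟩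
  have g0 : ∀ N, g N 0 = a := fun N => by simp [g, hab]
  let z : ℕ → ℕ → E := fun N k => Nat.rec q
    (fun k y => y + h (g N k) y (X (g N (k + 1)) - X (g N k))) k
  have hz : ∀ N k, z N (k + 1) = z N k + h (g N k) (z N k) (X (g N (k + 1)) - X (g N k)) :=
    fun N k => rfl
  have bound := fun N => euler_scheme_bound hα hH hB0 hL₁ hL₂ hK0 hX hB hL hK (gmono N) (gmem N)
    (hz N)
  let κ : ℕ → ℝ → ℕ := fun N t => ⌊(t - a) * (N + 1)⌋₊
  have gκ : ∀ N, ∀ t ∈ Icc a b, g N (κ N t) ≤ t ∧ t - 1 / (N + 1) ≤ g N (κ N t) := by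
    intro N t ht
    have hN : (0 : ℝ) < N + 1 := by positivity
    have h1 : (κ N t : ℝ) / (N + 1) ≤ t - a := by
      rw [div_le_iff₀ hN]
      exact Nat.floor_le (mul_nonneg (by linarith [ht.1]) hN.le)
    have h2 : t - a ≤ (κ N t + 1 : ℝ) / (N + 1) := by
      rw [le_div_iff₀ hN]
      exact (Nat.lt_floor_add_one _).le
    rw [add_div] at h2
    have : g N (κ N t) = a + κ N t / (N + 1) := min_eq_right (by linarith [ht.2])
    rw [this]
    constructor <;> linarith
  have glim : ∀ t ∈ Icc a b, Tendsto (fun N => g N (κ N t)) atTop (𝓝 t) := by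
    intro t ht
    have h1 : Tendsto (fun N : ℕ => t - 1 / ((N : ℝ) + 1)) atTop (𝓝 t) := by
      simpa using (tendsto_const_nhds (x := t)).sub (tendsto_one_div_add_atTop_nhds_zero_nat (𝕜 := ℝ))
    exact tendsto_of_tendsto_of_tendsto_of_le_of_le h1 tendsto_const_nhds
      (fun N => (gκ N t ht).2) (fun N => (gκ N t ht).1)
  have zbd : ∀ N k, z N k ∈ Metric.closedBall q
      (B * (H * (b - a) ^ α) + K * (b - a) ^ (2 * α)) := by
    intro N k
    have hb := bound N k 0
    rw [zero_add, g0] at hb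
    have hba : 0 ≤ b - a := sub_nonneg.2 hab
    have hg0 := (gmem N k).1
    have hg1 := (gmem N k).2
    have h1 : ‖h a (z N 0) (X (g N k) - X a)‖ ≤ B * (H * (b - a) ^ α) := by
      refine (ContinuousLinearMap.le_opNorm _ _).trans (mul_le_mul (hB _ (left_mem_Icc.2 hab) _)
        ((hX _ (left_mem_Icc.2 hab) _ (gmem N k)).trans ?_) (norm_nonneg _) hB0)
      rw [abs_of_nonneg (by linarith)]
      gcongr
    have h2 : K * (g N k - a) ^ (2 * α) ≤ K * (b - a) ^ (2 * α) := by
      gcongr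
    rw [Metric.mem_closedBall, dist_eq_norm]
    calc ‖z N k - q‖ = ‖(h a (z N 0) (X (g N k) - X a))
          + (z N k - z N 0 - h a (z N 0) (X (g N k) - X a))‖ := by
            congr 1
            have : z N 0 = q := rfl
            rw [this]; abel
      _ ≤ _ := norm_add_le_of_le h1 (hb.trans h2)
  let U : Ultrafilter ℕ := hyperfilter ℕ
  have hU : (U : Filter ℕ) ≤ atTop := Nat.hyperfilter_le_atTop
  have lim : ∀ t, ∃ y, Tendsto (fun N => z N (κ N t)) U (𝓝 y) := by
    intro t
    have : ProperSpace E := FiniteDimensional.proper_real E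
    obtain ⟨y, -, hy⟩ := (isCompact_closedBall q
      (B * (H * (b - a) ^ α) + K * (b - a) ^ (2 * α))).ultrafilter_le_nhds
      (U.map fun N => z N (κ N t) : Ultrafilter E)
      (le_principal_iff.2 (Ultrafilter.mem_map.2 (univ_mem' fun N => zbd N (κ N t))))
    exact ⟨y, hy⟩
  choose Y hY using lim
  have absα : ∀ s : ℝ, Tendsto (fun s' => |s' - s| ^ α) (𝓝 s) (𝓝 0) := by
    intro s
    have : Tendsto (fun s' : ℝ => |s' - s| ^ α) (𝓝 s) (𝓝 (|s - s| ^ α)) :=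
      ((continuous_id.sub continuous_const).abs.rpow_const (fun _ => Or.inr hα.le)).tendsto s
    simpa [Real.zero_rpow hα.ne'] using this
  have Xlim : ∀ s ∈ Icc a b, Tendsto (fun N => X (g N (κ N s))) U (𝓝 (X s)) := by
    intro s hs
    rw [tendsto_iff_norm_sub_tendsto_zero]
    refine squeeze_zero (fun _ => norm_nonneg _) (fun N => hX _ hs _ (gmem N _)) ?_
    simpa using ((absα s).comp ((glim s hs).mono_left hU)).const_mul H
  refine ⟨Y, ?_, fun s hs t ht hst => ?_⟩
  · refine tendsto_nhds_unique (hY a) ?_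
    have : (fun N => z N (κ N a)) = fun _ => q := by
      funext N
      simp [κ, z]
    rw [this]
    exact tendsto_const_nhds
  · have hlim : Tendsto (fun N => h (g N (κ N s)) (z N (κ N s))) U (𝓝 (h s (Y s))) := by
      rw [tendsto_iff_norm_sub_tendsto_zero]
      refine squeeze_zero (fun _ => norm_nonneg _) (fun N => hL _ hs _ (gmem N _) _ _) ?_
      have h1 := ((absα s).comp ((glim s hs).mono_left hU)).const_mul L₁
      have h2 := (tendsto_iff_norm_sub_tendsto_zero.1 (hY s)).const_mul L₂
      simpa using h1.add h2
    have l0 := ((isBoundedBilinearMap_apply (𝕜 := ℝ) (E := V) (F := E)).continuous.tendsto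
      (h s (Y s), X t - X s)).comp (hlim.prodMk_nhds ((Xlim t ht).sub (Xlim s hs)))
    have l1 := (((hY t).sub (hY s)).sub l0).norm
    have l2 : Tendsto (fun N => K * (g N (κ N t) - g N (κ N s)) ^ (2 * α)) U
        (𝓝 (K * (t - s) ^ (2 * α))) :=
      (((((glim t ht).sub (glim s hs)).mono_left hU).rpow_const
        (Or.inr (by linarith))).const_mul K)
    refine le_of_tendsto_of_tendsto' l1 l2 fun N => ?_
    have hκ : κ N s ≤ κ N t := Nat.floor_mono (by gcongr)
    obtain ⟨m, hm⟩ := Nat.exists_eq_add_of_le hκ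
    have := bound N m (κ N s)
    rwa [← hm] at this

end Euler

/-! ### Two-parameter functions of prescribed order near the diagonal -/

section NearO

variable {E F : Type*} [NormedAddCommGroup E] [NormedSpace ℝ E]
  [NormedAddCommGroup F]

/-- The two-parameter function `g` is of order `|t - s| ^ θ` as `s` and `t` tend to a common limit
along `l`; in the applications `l = 𝓝[J] r`. -/
def NearO (θ : ℝ) (l : Filter ℝ) (g : ℝ → ℝ → F) : Prop :=
  (fun q : ℝ × ℝ ↦ g q.1 q.2) =O[l ×ˢ l] fun q ↦ |q.2 - q.1| ^ θ

variable {θ α : ℝ} {l l' : Filter ℝ} {g g' : ℝ → ℝ → F}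

theorem NearO.mono (h : NearO θ l g) (hl : l' ≤ l) : NearO θ l' g :=
  Asymptotics.IsBigO.mono h (prod_mono hl hl)

theorem NearO.add (h : NearO θ l g) (h' : NearO θ l g') : NearO θ l (fun s t ↦ g s t + g' s t) :=
  Asymptotics.IsBigO.add h h'

theorem NearO.sub (h : NearO θ l g) (h' : NearO θ l g') : NearO θ l (fun s t ↦ g s t - g' s t) :=
  Asymptotics.IsBigO.sub h h'

theorem NearO.congr {p : ℝ → Prop} (h : NearO θ l g) (hp : ∀ᶠ s in l, p s)
    (hg : ∀ s t, p s → p t → g s t = g' s t) : NearO θ l g' := by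
  refine Asymptotics.IsBigO.congr' h ?_ EventuallyEq.rfl
  filter_upwards [hp.prod_mk hp] with q hq using hg _ _ hq.1 hq.2

theorem nearO_nhdsWithin_iff {J : Set ℝ} {r : ℝ} :
    NearO θ (𝓝[J] r) g ↔ ∃ C, 0 ≤ C ∧ ∃ δ > 0, ∀ s ∈ J, ∀ t ∈ J, |s - r| < δ → |t - r| < δ →
      ‖g s t‖ ≤ C * |t - s| ^ θ := by
  have hb : (𝓝[J] r ×ˢ 𝓝[J] r).HasBasis (fun δ : ℝ ↦ 0 < δ)
      (fun δ ↦ (Metric.ball r δ ∩ J) ×ˢ (Metric.ball r δ ∩ J)) :=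
    (Metric.nhdsWithin_basis_ball (x := r) (s := J)).prod_self
  constructor
  · intro h
    obtain ⟨C, hC, hO⟩ := Asymptotics.IsBigO.exists_nonneg h
    obtain ⟨δ, hδ, hsub⟩ := hb.eventually_iff.1 hO.bound
    refine ⟨C, hC, δ, hδ, fun s hs t ht hsr htr ↦ ?_⟩
    have := hsub (x := (s, t)) ⟨⟨by rwa [Metric.mem_ball, Real.dist_eq], hs⟩,
      ⟨by rwa [Metric.mem_ball, Real.dist_eq], ht⟩⟩
    rwa [Real.norm_of_nonneg (by positivity)] at this
  · rintro ⟨C, -, δ, hδ, h⟩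
    refine Asymptotics.IsBigO.of_bound C (hb.eventually_iff.2 ⟨δ, hδ, fun q hq ↦ ?_⟩)
    rw [Real.norm_of_nonneg (by positivity)]
    simp only [mem_prod, mem_inter_iff, Metric.mem_ball, Real.dist_eq] at hq
    exact h _ hq.1.2 _ hq.2.2 hq.1.1 hq.2.1

/-- A bound for `s ≤ t` extends to all pairs if the symmetrization is controlled. -/
theorem nearO_of_le {J : Set ℝ} {r C δ : ℝ} (hδ : 0 < δ)
    (h : ∀ s ∈ J, ∀ t ∈ J, |s - r| < δ → |t - r| < δ → s ≤ t → ‖g s t‖ ≤ C * |t - s| ^ θ)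
    (hs : NearO θ (𝓝[J] r) (fun s t ↦ g s t + g t s)) : NearO θ (𝓝[J] r) g := by
  obtain ⟨C', hC', δ', hδ', h'⟩ := nearO_nhdsWithin_iff.1 hs
  refine nearO_nhdsWithin_iff.2 ⟨|C| + C', by positivity, min δ δ', lt_min hδ hδ',
    fun s hs t ht hsr htr ↦ ?_⟩
  have hp : 0 ≤ |t - s| ^ θ := by positivity
  have hC : C * |t - s| ^ θ ≤ |C| * |t - s| ^ θ := by gcongr; exact le_abs_self C
  have h1 : 0 ≤ C' * |t - s| ^ θ := by positivity
  rw [add_mul]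
  rcases le_total s t with hst | hst
  · linarith [h s hs t ht (hsr.trans_le (min_le_left _ _)) (htr.trans_le (min_le_left _ _)) hst]
  · have e1 := h t ht s hs (htr.trans_le (min_le_left _ _)) (hsr.trans_le (min_le_left _ _)) hst
    have e2 := h' s hs t ht (hsr.trans_le (min_le_right _ _)) (htr.trans_le (min_le_right _ _))
    rw [abs_sub_comm] at e1
    calc ‖g s t‖ = ‖(g s t + g t s) - g t s‖ := by rw [add_sub_cancel_right]
      _ ≤ _ := norm_sub_le _ _
      _ ≤ _ := by linarith

/-- On a compact set, a local estimate near the diagonal is uniform. -/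
theorem exists_uniform_of_nearO {J : Set ℝ} (hJ : IsCompact J)
    (h : ∀ r ∈ J, NearO θ (𝓝[J] r) g) :
    ∃ C, 0 ≤ C ∧ ∃ δ > 0, ∀ s ∈ J, ∀ t ∈ J, |t - s| < δ → ‖g s t‖ ≤ C * |t - s| ^ θ := by
  refine hJ.induction_on (p := fun S ↦ ∃ C, 0 ≤ C ∧ ∃ δ > 0, ∀ s ∈ S, ∀ t ∈ J, |t - s| < δ →
    ‖g s t‖ ≤ C * |t - s| ^ θ) ⟨0, le_rfl, 1, one_pos, by simp⟩ ?_ ?_ ?_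
  · rintro S S' hS ⟨C, hC, δ, hδ, h'⟩
    exact ⟨C, hC, δ, hδ, fun s hs ↦ h' s (hS hs)⟩
  · rintro S S' ⟨C, hC, δ, hδ, h1⟩ ⟨C', hC', δ', hδ', h2⟩
    refine ⟨C + C', by positivity, min δ δ', lt_min hδ hδ', ?_⟩
    rintro s (hs | hs) t ht hst
    · have := h1 s hs t ht (hst.trans_le (min_le_left _ _))
      have : 0 ≤ C' * |t - s| ^ θ := by positivity
      linarith
    · have := h2 s hs t ht (hst.trans_le (min_le_right _ _))
      have : 0 ≤ C * |t - s| ^ θ := by positivity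
      linarith
  · intro r hr
    obtain ⟨C, hC, δ, hδ, h'⟩ := nearO_nhdsWithin_iff.1 (h r hr)
    refine ⟨Metric.ball r (δ / 2) ∩ J, ?_, C, hC, δ / 2, half_pos hδ, ?_⟩
    · exact inter_mem (mem_nhdsWithin_of_mem_nhds (Metric.ball_mem_nhds _ (half_pos hδ)))
        self_mem_nhdsWithin
    · rintro s ⟨hs, hsJ⟩ t ht hst
      rw [Metric.mem_ball, Real.dist_eq] at hs
      refine h' s hsJ t ht (by linarith) ?_
      have := abs_add_le (t - s) (s - r)
      rw [sub_add_sub_cancel] at this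
      linarith

theorem NearO.exists_forall_near {θ r : ℝ} {J : Set ℝ} {g : ℝ → ℝ → F} (h : NearO θ (𝓝[J] r) g) :
    ∃ ε > 0, ∀ r', |r' - r| < ε → NearO θ (𝓝[J] r') g := by
  obtain ⟨C, hC, δ, hδ, hb⟩ := nearO_nhdsWithin_iff.1 h
  refine ⟨δ, hδ, fun r' hr' ↦ nearO_nhdsWithin_iff.2 ⟨C, hC, δ - |r' - r|, by linarith,
    fun s hs t ht hsr htr ↦ hb s hs t ht ?_ ?_⟩⟩
  · have := abs_add_le (s - r') (r' - r)
    rw [sub_add_sub_cancel] at this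
    linarith
  · have := abs_add_le (t - r') (r' - r)
    rw [sub_add_sub_cancel] at this
    linarith

theorem NearO.continuousWithinAt (hα : 0 < α)
    {J : Set ℝ} {r : ℝ} (hr : r ∈ J) {Y : ℝ → F} (h : NearO α (𝓝[J] r) (fun s t ↦ Y t - Y s)) :
    ContinuousWithinAt Y J r := by
  obtain ⟨C, hC, δ, hδ, hb⟩ := nearO_nhdsWithin_iff.1 h
  have hlim : Tendsto (fun t : ℝ ↦ C * |t - r| ^ α) (𝓝[J] r) (𝓝 0) := by
    have : Tendsto (fun t : ℝ ↦ C * |t - r| ^ α) (𝓝 r) (𝓝 (C * |r - r| ^ α)) :=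
      (continuous_const.mul ((continuous_id.sub continuous_const).abs.rpow_const
        (fun _ ↦ Or.inr hα.le))).tendsto r
    rw [sub_self, abs_zero, Real.zero_rpow hα.ne', mul_zero] at this
    exact this.mono_left nhdsWithin_le_nhds
  refine tendsto_iff_norm_sub_tendsto_zero.2 (squeeze_zero' (Eventually.of_forall fun _ ↦
    norm_nonneg _) ?_ hlim)
  filter_upwards [self_mem_nhdsWithin, mem_nhdsWithin_of_mem_nhds (Metric.ball_mem_nhds r hδ)]
    with t htJ htr
  rw [Metric.mem_ball, Real.dist_eq] at htr
  exact hb r hr t htJ (by simpa using hδ) htr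

variable [NormedSpace ℝ F]

theorem NearO.clm_apply {A : ℝ → E →L[ℝ] F} {g : ℝ → ℝ → E} (h : NearO θ l g) {C : ℝ}
    (hA : ∀ᶠ s in l, ‖A s‖ ≤ C) : NearO θ l (fun s t ↦ A s (g s t)) := by
  refine Asymptotics.IsBigO.trans (Asymptotics.IsBigO.of_bound C ?_) h
  filter_upwards [tendsto_fst.eventually hA] with q hq
  exact (ContinuousLinearMap.le_opNorm _ _).trans (by gcongr)

theorem NearO.clm_apply₂ {A : ℝ → ℝ → E →L[ℝ] F} {g : ℝ → ℝ → E} (hA : NearO α l A)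
    (hg : NearO α l g) : NearO (2 * α) l (fun s t ↦ A s t (g s t)) := by
  refine Asymptotics.IsBigO.trans (Asymptotics.IsBigO.of_bound 1 ?_)
    ((Asymptotics.IsBigO.mul hA.norm_left hg.norm_left).congr_right fun q ↦ ?_)
  · refine Eventually.of_forall fun q ↦ ?_
    rw [one_mul, norm_mul, norm_norm, norm_norm]
    exact ContinuousLinearMap.le_opNorm _ _
  · exact (rpow_two_mul_eq (abs_nonneg _)).symm

/-- Increments of order larger than one vanish. -/
theorem eq_of_nearO {J : Set ℝ} (hJ : J.OrdConnected) (hθ : 1 < θ) {f : ℝ → F}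
    (h : ∀ r ∈ J, NearO θ (𝓝[J] r) (fun s t ↦ f t - f s)) {s t : ℝ} (hs : s ∈ J) (ht : t ∈ J) :
    f t = f s := by
  have hd : ∀ r ∈ J, HasDerivWithinAt f 0 J r := by
    intro r hr
    rw [hasDerivWithinAt_iff_isLittleO]
    obtain ⟨C, hC, δ, hδ, hb⟩ := nearO_nhdsWithin_iff.1 (h r hr)
    have h1 : (fun t ↦ f t - f r - (t - r) • (0 : F)) =O[𝓝[J] r] fun t ↦ |t - r| ^ θ := by
      refine Asymptotics.IsBigO.of_bound C ?_
      filter_upwards [self_mem_nhdsWithin,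
        mem_nhdsWithin_of_mem_nhds (Metric.ball_mem_nhds r hδ)] with t htJ htr
      rw [Metric.mem_ball, Real.dist_eq] at htr
      rw [Real.norm_of_nonneg (by positivity)]
      simpa using hb r hr t htJ (by simpa using hδ) htr
    refine h1.trans_isLittleO ?_
    rw [Asymptotics.isLittleO_iff]
    intro c hc
    have hlim : Tendsto (fun t : ℝ ↦ |t - r| ^ (θ - 1)) (𝓝[J] r) (𝓝 0) := by
      have : Tendsto (fun t : ℝ ↦ |t - r| ^ (θ - 1)) (𝓝 r) (𝓝 (|r - r| ^ (θ - 1))) :=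
        ((continuous_id.sub continuous_const).abs.rpow_const
          (fun _ ↦ Or.inr (by linarith))).tendsto r
      rw [sub_self, abs_zero, Real.zero_rpow (by linarith)] at this
      exact this.mono_left nhdsWithin_le_nhds
    filter_upwards [hlim.eventually_le_const hc] with t htc
    rw [Real.norm_of_nonneg (by positivity), Real.norm_eq_abs]
    rcases eq_or_ne (|t - r|) 0 with h0 | h0
    · rw [h0, Real.zero_rpow (by linarith), mul_zero]
    · have : |t - r| ^ θ = |t - r| ^ (θ - 1) * |t - r| := by
        rw [← Real.rpow_add_one h0, sub_add_cancel]
      rw [this]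
      gcongr
  have := hJ.convex.norm_image_sub_le_of_norm_hasDerivWithin_le (C := 0) hd (by simp) hs ht
  rw [zero_mul] at this
  exact sub_eq_zero.1 (norm_le_zero_iff.1 this)

/-- A `C²` map has, near a point, bounded and Lipschitz derivative. -/
theorem exists_bound_fderiv {f : E → F} {z : E} (hf : ContDiffAt ℝ 2 f z) :
    ∃ L, 0 ≤ L ∧ ∃ ρ > 0, ∀ x ∈ Metric.ball z ρ, DifferentiableAt ℝ f x ∧ ‖fderiv ℝ f x‖ ≤ L ∧
      ∀ y ∈ Metric.ball z ρ, ‖fderiv ℝ f y - fderiv ℝ f x‖ ≤ L * ‖y - x‖ := by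
  have h1 : ContDiffAt ℝ 1 (fderiv ℝ f) z := hf.fderiv_right (by norm_num)
  obtain ⟨K, t, ht, hK⟩ := h1.exists_lipschitzOnWith
  have h2 : ∀ᶠ x in 𝓝 z, ‖fderiv ℝ f x‖ < ‖fderiv ℝ f z‖ + 1 :=
    h1.continuousAt.norm.eventually_lt_const (by linarith)
  have h3 : ∀ᶠ x in 𝓝 z, DifferentiableAt ℝ f x :=
    (hf.eventually (by norm_num)).mono fun x hx ↦ hx.differentiableAt (by norm_num)
  obtain ⟨ρ, hρ, hsub⟩ := Metric.eventually_nhds_iff_ball.1 (h3.and (h2.and ht))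
  refine ⟨K + (‖fderiv ℝ f z‖ + 1), by positivity, ρ, hρ, fun x hx ↦
    ⟨(hsub x hx).1, ?_, fun y hy ↦ ?_⟩⟩
  · linarith [(hsub x hx).2.1, K.2]
  · have := hK.norm_sub_le (hsub y hy).2.2 (hsub x hx).2.2
    refine this.trans ?_
    gcongr
    linarith [norm_nonneg (fderiv ℝ f z)]

theorem exists_bound_taylor {f : E → F} {z : E} (hf : ContDiffAt ℝ 2 f z) :
    ∃ L, 0 ≤ L ∧ ∃ ρ > 0, ∀ x ∈ Metric.ball z ρ, ∀ y ∈ Metric.ball z ρ,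
      ‖f y - f x‖ ≤ L * ‖y - x‖ ∧ ‖f y - f x - fderiv ℝ f x (y - x)‖ ≤ L * ‖y - x‖ * ‖y - x‖ := by
  obtain ⟨L, hL, ρ, hρ, h⟩ := exists_bound_fderiv hf
  refine ⟨L, hL, ρ, hρ, fun x hx y hy ↦ ⟨?_, ?_⟩⟩
  · exact (convex_ball z ρ).norm_image_sub_le_of_norm_fderiv_le (fun w hw ↦ (h w hw).1)
      (fun w hw ↦ (h w hw).2.1) hx hy
  · have hseg : segment ℝ x y ⊆ Metric.ball z ρ := (convex_ball z ρ).segment_subset hx hy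
    refine (convex_segment x y).norm_image_sub_le_of_norm_hasFDerivWithin_le'
      (fun w hw ↦ (h w (hseg hw)).1.hasFDerivAt.hasFDerivWithinAt) (fun w hw ↦ ?_)
      (left_mem_segment ℝ x y) (right_mem_segment ℝ x y)
    refine ((h x hx).2.2 w (hseg hw)).trans ?_
    gcongr
    obtain ⟨c, d, hc, hd, hcd, rfl⟩ := hw
    have : c • x + d • y - x = d • (y - x) := by
      rw [← sub_eq_iff_eq_add.2 hcd.symm]
      module
    rw [this, norm_smul, Real.norm_of_nonneg hd]
    exact mul_le_of_le_one_left (norm_nonneg _) (by linarith)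

/-- The four-point estimate for a `C²` map: the second difference is controlled by the difference of
the increments `y - y'`, `w - w'` and by the size of one of them. -/
theorem exists_bound_four_point {f : E → F} {z : E} (hf : ContDiffAt ℝ 2 f z) :
    ∃ L, 0 ≤ L ∧ ∃ ρ > 0, ∀ y ∈ Metric.ball z ρ, ∀ y' ∈ Metric.ball z ρ, ∀ w ∈ Metric.ball z ρ,
      ∀ w' ∈ Metric.ball z ρ, ‖(f y - f y') - (f w - f w')‖
        ≤ L * ‖(y - y') - (w - w')‖ + L * (‖y - w‖ + ‖y' - w'‖) * ‖w - w'‖ := by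
  obtain ⟨L, hL, ρ, hρ, h⟩ := exists_bound_fderiv hf
  refine ⟨L, hL, ρ, hρ, fun y hy y' hy' w hw w' hw' ↦ ?_⟩
  have mem : ∀ p ∈ Metric.ball z ρ, ∀ p' ∈ Metric.ball z ρ, ∀ c ∈ Icc (0 : ℝ) 1,
      p' + c • (p - p') ∈ Metric.ball z ρ := fun p hp p' hp' c hc ↦
    (convex_ball z ρ).add_smul_sub_mem hp' hp hc
  have der : ∀ p ∈ Metric.ball z ρ, ∀ p' ∈ Metric.ball z ρ, ∀ c ∈ Icc (0 : ℝ) 1,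
      HasDerivAt (fun c : ℝ ↦ f (p' + c • (p - p'))) (fderiv ℝ f (p' + c • (p - p')) (p - p')) c := by
    intro p hp p' hp' c hc
    have h1 : HasDerivAt (fun c : ℝ ↦ p' + c • (p - p')) (p - p') c := by
      simpa using ((hasDerivAt_id c).smul_const (p - p')).const_add p'
    exact (h _ (mem p hp p' hp' c hc)).1.hasFDerivAt.comp_hasDerivAt c h1
  have := norm_image_sub_le_of_norm_deriv_le_segment_01'
    (f := fun c : ℝ ↦ f (y' + c • (y - y')) - f (w' + c • (w - w')))
    (C := L * ‖(y - y') - (w - w')‖ + L * (‖y - w‖ + ‖y' - w'‖) * ‖w - w'‖)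
    (fun c hc ↦ ((der y hy y' hy' c hc).sub (der w hw w' hw' c hc)).hasDerivWithinAt) ?_
  · simp only [one_smul, add_sub_cancel, zero_smul, add_zero] at this
    convert this using 2
    abel
  · intro c hc
    have hc' : c ∈ Icc (0 : ℝ) 1 := ⟨hc.1, hc.2.le⟩
    have m1 := mem y hy y' hy' c hc'
    have m2 := mem w hw w' hw' c hc'
    set p := y' + c • (y - y')
    set q := w' + c • (w - w')
    have hpq : ‖p - q‖ ≤ ‖y - w‖ + ‖y' - w'‖ := by
      have : p - q = c • (y - w) + (1 - c) • (y' - w') := by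
        simp only [p, q]
        module
      rw [this]
      refine norm_add_le_of_le ?_ ?_
      · rw [norm_smul, Real.norm_of_nonneg hc.1]
        exact mul_le_of_le_one_left (norm_nonneg _) hc'.2
      · rw [norm_smul, Real.norm_of_nonneg (by linarith [hc'.2])]
        exact mul_le_of_le_one_left (norm_nonneg _) (by linarith [hc'.1])
    have e : fderiv ℝ f p (y - y') - fderiv ℝ f q (w - w')
        = fderiv ℝ f p ((y - y') - (w - w')) + (fderiv ℝ f p - fderiv ℝ f q) (w - w') := by
      simp only [map_sub, _root_.sub_apply]
      abel
    rw [e]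
    refine norm_add_le_of_le ?_ ?_
    · exact (ContinuousLinearMap.le_opNorm _ _).trans (by gcongr; exact (h p m1).2.1)
    · refine (ContinuousLinearMap.le_opNorm _ _).trans ?_
      gcongr
      exact ((h q m2).2.2 p m1).trans (by gcongr)

theorem NearO.comp_contDiffAt {Y : ℝ → E} {f : E → F} {z : E} (hY : NearO α l (fun s t ↦ Y t - Y s))
    (hz : Tendsto Y l (𝓝 z)) (hf : ContDiffAt ℝ 2 f z) : NearO α l (fun s t ↦ f (Y t) - f (Y s)) := by
  obtain ⟨L, hL, ρ, hρ, h⟩ := exists_bound_taylor hf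
  have hb := hz.eventually (Metric.ball_mem_nhds z hρ)
  refine Asymptotics.IsBigO.trans (Asymptotics.IsBigO.of_bound L ?_) hY
  filter_upwards [hb.prod_mk hb] with q hq using (h _ hq.1 _ hq.2).1

theorem nearO_taylor {Y : ℝ → E} {f : E → F} {z : E} (hY : NearO α l (fun s t ↦ Y t - Y s))
    (hz : Tendsto Y l (𝓝 z)) (hf : ContDiffAt ℝ 2 f z) :
    NearO (2 * α) l (fun s t ↦ f (Y t) - f (Y s) - fderiv ℝ f (Y s) (Y t - Y s)) := by
  obtain ⟨L, hL, ρ, hρ, h⟩ := exists_bound_taylor hf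
  have hb := hz.eventually (Metric.ball_mem_nhds z hρ)
  refine Asymptotics.IsBigO.trans (Asymptotics.IsBigO.of_bound L ?_)
    ((Asymptotics.IsBigO.mul hY.norm_left hY.norm_left).congr_right fun q ↦
      (rpow_two_mul_eq (abs_nonneg _)).symm)
  filter_upwards [hb.prod_mk hb] with q hq
  rw [Real.norm_of_nonneg (by positivity), ← mul_assoc]
  exact (h _ hq.1 _ hq.2).2

end NearO

/-! ### Young equations and Riemann-Stieltjes integrals -/

section YoungEquation

variable {E V F : Type*} [NormedAddCommGroup E] [NormedSpace ℝ E]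
  [NormedAddCommGroup V] [NormedSpace ℝ V] [NormedAddCommGroup F] [NormedSpace ℝ F]
  {α : ℝ}

theorem two_rpow_lt_one (hα : 1 / 2 < α) : (2 : ℝ) ^ (1 - 2 * α) < 1 :=
  Real.rpow_lt_one_of_one_lt_of_neg (by norm_num) (by linarith)

theorem tendsto_two_mul_rpow (hα : 0 < α) :
    Tendsto (fun δ : ℝ ↦ (2 * δ) ^ α) (𝓝[>] 0) (𝓝 0) := by
  have : Tendsto (fun δ : ℝ ↦ (2 * δ) ^ α) (𝓝 0) (𝓝 ((2 * 0) ^ α)) :=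
    ((continuous_const.mul continuous_id).rpow_const (fun _ ↦ Or.inr hα.le)).tendsto 0
  rw [mul_zero, Real.zero_rpow hα.ne'] at this
  exact this.mono_left nhdsWithin_le_nhds

/-- The one-sided estimate `s ≤ t` for `Y_t - Y_s - A_s (X_t - X_s)` gives the two-sided one, since
exchanging `s` and `t` costs only `(A_t - A_s) (X_t - X_s)`. -/
theorem nearO_incr_of_le {J : Set ℝ} {r C δ : ℝ} (hδ : 0 < δ) {Y : ℝ → F} {X : ℝ → E}
    {A : ℝ → E →L[ℝ] F}
    (h : ∀ s ∈ J, ∀ t ∈ J, |s - r| < δ → |t - r| < δ → s ≤ t →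
      ‖Y t - Y s - A s (X t - X s)‖ ≤ C * |t - s| ^ (2 * α))
    (hX : NearO α (𝓝[J] r) (fun s t ↦ X t - X s)) (hA : NearO α (𝓝[J] r) (fun s t ↦ A t - A s)) :
    NearO (2 * α) (𝓝[J] r) (fun s t ↦ Y t - Y s - A s (X t - X s)) := by
  refine nearO_of_le hδ h ((hA.clm_apply₂ hX).congr (p := fun _ ↦ True) (by simp) fun s t _ _ ↦ ?_)
  simp only [map_sub, _root_.sub_apply]
  abel

/-- The Young integral `I` of `A` against `X` exists near every point, in the sense that its
increments are `A_s (X_t - X_s)` up to order `2α`. -/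
theorem exists_local_primitive [FiniteDimensional ℝ F] (hα : 1 / 2 < α) {a b r : ℝ}
    (hr : r ∈ Icc a b) {X : ℝ → E} {A : ℝ → E →L[ℝ] F}
    (hX : NearO α (𝓝[Icc a b] r) (fun s t ↦ X t - X s))
    (hA : NearO α (𝓝[Icc a b] r) (fun s t ↦ A t - A s)) :
    ∃ I : ℝ → F, ∃ ε > 0, ∀ r', |r' - r| < ε →
      NearO (2 * α) (𝓝[Icc a b] r') (fun s t ↦ I t - I s - A s (X t - X s)) := by
  have hρ := two_rpow_lt_one hα
  obtain ⟨C₁, hC₁, δ₁, hδ₁, h₁⟩ := nearO_nhdsWithin_iff.1 hX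
  obtain ⟨C₂, hC₂, δ₂, hδ₂, h₂⟩ := nearO_nhdsWithin_iff.1 hA
  obtain ⟨ε₁, hε₁, n₁⟩ := hX.exists_forall_near
  obtain ⟨ε₂, hε₂, n₂⟩ := hA.exists_forall_near
  obtain ⟨ε, hε, hlt⟩ := exists_between (lt_min (lt_min hδ₁ hδ₂) (lt_min hε₁ hε₂))
  simp only [lt_min_iff] at hlt
  have hmem : ∀ s ∈ Icc (max a (r - ε)) (min b (r + ε)), s ∈ Icc a b ∧ |s - r| ≤ ε := by
    intro s hs
    simp only [mem_Icc, max_le_iff, le_min_iff] at hs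
    exact ⟨⟨hs.1.1, hs.2.1⟩, abs_le.2 ⟨by linarith, by linarith⟩⟩
  have hle : max a (r - ε) ≤ min b (r + ε) :=
    max_le (le_min (hr.1.trans hr.2) (by linarith [hr.1])) (le_min (by linarith [hr.2]) (by linarith))
  have hA' : ∀ s ∈ Icc (max a (r - ε)) (min b (r + ε)), ∀ t ∈ Icc (max a (r - ε)) (min b (r + ε)),
      ‖A t - A s‖ ≤ C₂ * |t - s| ^ α := fun s hs t ht ↦
    h₂ s (hmem s hs).1 t (hmem t ht).1 ((hmem s hs).2.trans_lt hlt.1.2)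
      ((hmem t ht).2.trans_lt hlt.1.2)
  obtain ⟨I, -, hI⟩ := exists_young_solution (E := F) (α := α) (H := C₁)
    (B := ‖A (max a (r - ε))‖ + C₂ * (min b (r + ε) - max a (r - ε)) ^ α) (L₁ := C₂) (L₂ := 0)
    (K := 2 * C₁ * C₂ / (1 - 2 ^ (1 - 2 * α))) (h := fun s _ ↦ A s) (X := X)
    (by linarith) hle hC₁
    (by have : 0 ≤ min b (r + ε) - max a (r - ε) := sub_nonneg.2 hle
        positivity) hC₂ le_rfl
    (div_nonneg (by positivity) (by linarith))
    (fun s hs t ht ↦ h₁ s (hmem s hs).1 t (hmem t ht).1 ((hmem s hs).2.trans_lt hlt.1.1)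
      ((hmem t ht).2.trans_lt hlt.1.1))
    (fun s hs _ ↦ by
      have h3 := hA' _ (left_mem_Icc.2 hle) s hs
      have h4 : |s - max a (r - ε)| ^ α ≤ (min b (r + ε) - max a (r - ε)) ^ α := by
        rw [abs_of_nonneg (sub_nonneg.2 hs.1)]
        exact Real.rpow_le_rpow (sub_nonneg.2 hs.1) (by linarith [hs.2]) (by linarith)
      calc ‖A s‖ = ‖A (max a (r - ε)) + (A s - A (max a (r - ε)))‖ := by rw [add_sub_cancel]
        _ ≤ _ := norm_add_le_of_le le_rfl (h3.trans (by gcongr)))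
    (fun s hs t ht _ _ ↦ by rw [zero_mul, add_zero]; exact hA' s hs t ht)
    (by
      have h5 : 1 - (2 : ℝ) ^ (1 - 2 * α) ≠ 0 := by linarith
      rw [zero_mul, add_zero]
      apply le_of_eq
      field_simp
      ring) 0
  refine ⟨I, ε, hε, fun r' hr' ↦ nearO_incr_of_le
    (C := 2 * C₁ * C₂ / (1 - 2 ^ (1 - 2 * α))) (δ := ε - |r' - r|) (by linarith) ?_
    (n₁ r' (hr'.trans hlt.2.1)) (n₂ r' (hr'.trans hlt.2.2))⟩
  have hin : ∀ s ∈ Icc a b, |s - r'| < ε - |r' - r| →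
      s ∈ Icc (max a (r - ε)) (min b (r + ε)) := by
    intro s hs hsr
    have := abs_add_le (s - r') (r' - r)
    rw [sub_add_sub_cancel] at this
    have := abs_le.1 (this.trans (by linarith : _ ≤ ε))
    exact ⟨max_le hs.1 (by linarith), le_min hs.2 (by linarith)⟩
  intro s hs t ht hsr htr hst
  rw [abs_of_nonneg (sub_nonneg.2 hst)]
  exact hI s (hin s hs hsr) t (hin t ht htr) hst

/-- Near a point, a `C²` map coincides with a bounded, globally Lipschitz one. -/
theorem exists_cutoff [FiniteDimensional ℝ E] {h : E → F} {z₀ : E} (hh : ContDiffAt ℝ 2 h z₀) :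
    ∃ (f : E → F) (B L : ℝ), 0 ≤ B ∧ 0 ≤ L ∧ (∀ z, ‖f z‖ ≤ B) ∧
      (∀ z z', ‖f z' - f z‖ ≤ L * ‖z' - z‖) ∧ ContDiff ℝ 2 f ∧ ∀ᶠ z in 𝓝 z₀, f z = h z := by
  obtain ⟨ρ, hρ, hsub⟩ := Metric.eventually_nhds_iff_ball.1 (hh.eventually (by norm_num))
  let χ : ContDiffBump z₀ := ⟨ρ / 4, ρ / 2, by positivity, by linarith⟩
  have hsm : ContDiff ℝ 2 (fun z ↦ χ z • h z) := by
    rw [contDiff_iff_contDiffAt]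
    intro z
    by_cases hz : z ∈ Metric.ball z₀ ρ
    · exact χ.contDiffAt.smul (hsub z hz)
    · have hz' : z ∈ (Metric.closedBall z₀ (ρ / 2))ᶜ := fun h' ↦
        hz (Metric.closedBall_subset_ball (by linarith) h')
      refine (contDiffAt_const (c := (0 : F))).congr_of_eventuallyEq ?_
      filter_upwards [Metric.isClosed_closedBall.isOpen_compl.mem_nhds hz'] with w hw
      rw [χ.zero_of_le_dist (le_of_not_ge fun h' ↦ hw h'), zero_smul]
  have hcs : HasCompactSupport (fun z ↦ χ z • h z) := χ.hasCompactSupport.smul_right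
  obtain ⟨B, hB⟩ := hcs.exists_bound_of_continuous hsm.continuous
  obtain ⟨L, hL⟩ := ContDiff.lipschitzWith_of_hasCompactSupport hcs hsm (by norm_num)
  refine ⟨fun z ↦ χ z • h z, B, L, (norm_nonneg _).trans (hB z₀), L.2, hB,
    fun z z' ↦ hL.norm_sub_le _ _, hsm, ?_⟩
  filter_upwards [Metric.closedBall_mem_nhds z₀ (show 0 < ρ / 4 by positivity)] with z hz
  rw [χ.one_of_mem_closedBall hz, one_smul]

/-- Local existence for the Young equation `dY = h(Y) dX`, on a time interval that does not depend on
the initial time and the initial point near `(r, z₀)`. -/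
theorem exists_local_young_solution [FiniteDimensional ℝ E] (hα : 1 / 2 < α) {h : E → V →L[ℝ] E}
    {z₀ : E} (hh : ContDiffAt ℝ 2 h z₀) {a b r : ℝ} {X : ℝ → V}
    (hX : NearO α (𝓝[Icc a b] r) (fun s t ↦ X t - X s)) {U : Set E} (hU : U ∈ 𝓝 z₀) :
    ∃ ε₀ > 0, ∀ ε, 0 < ε → ε < ε₀ → ∃ W ∈ 𝓝 z₀, ∀ s ∈ Icc a b, |s - r| < ε → ∀ q ∈ W,
      ∃ Y : ℝ → E, Y s = q ∧
      (∀ t ∈ Icc s (min b (r + ε)), Y t ∈ U) ∧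
      ∀ r' ∈ Icc s (min b (r + ε)),
        NearO α (𝓝[Icc s (min b (r + ε))] r') (fun s t ↦ Y t - Y s) ∧
        NearO (2 * α) (𝓝[Icc s (min b (r + ε))] r')
          (fun s t ↦ Y t - Y s - h (Y s) (X t - X s)) := by
  have hρ := two_rpow_lt_one hα
  obtain ⟨f, B, L, hB, hL, hfB, hfL, -, hfh⟩ := exists_cutoff hh
  obtain ⟨H, hH, δ₁, hδ₁, h₁⟩ := nearO_nhdsWithin_iff.1 hX
  obtain ⟨ρ, hρ0, hball⟩ := Metric.eventually_nhds_iff_ball.1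
    (hfh.and (show ∀ᶠ z in 𝓝 z₀, z ∈ U from hU))
  set K : ℝ := 2 * H * (L * (2 * B * H + 1)) / (1 - 2 ^ (1 - 2 * α)) with hKdef
  have hK0 : 0 ≤ K := div_nonneg (by positivity) (by linarith)
  have hlim := tendsto_two_mul_rpow (α := α) (by linarith)
  have ev : ∀ᶠ ε in 𝓝[>] (0 : ℝ), K * (2 * ε) ^ α < 1 ∧ (B * H + 1) * (2 * ε) ^ α < ρ / 2 ∧
      ε < δ₁ := by
    refine Eventually.and ?_ (Eventually.and ?_ ?_)
    · have := hlim.const_mul K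
      rw [mul_zero] at this
      exact this.eventually_lt_const one_pos
    · have := hlim.const_mul (B * H + 1)
      rw [mul_zero] at this
      exact this.eventually_lt_const (by positivity)
    · exact mem_nhdsWithin_of_mem_nhds (Iio_mem_nhds hδ₁)
  obtain ⟨ε₀, hε₀, hev⟩ := mem_nhdsGT_iff_exists_Ioo_subset.1 ev
  refine ⟨ε₀, hε₀, fun ε hε hεε ↦ ?_⟩
  obtain ⟨e1, e2, e3⟩ := hev ⟨hε, hεε⟩
  refine ⟨Metric.ball z₀ (ρ / 2), Metric.ball_mem_nhds _ (by positivity), fun s hs hsr q hq ↦ ?_⟩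
  set b' := min b (r + ε)
  have hsb : s ≤ b' := le_min hs.2 (by linarith [(abs_lt.1 hsr).2])
  have hlen : b' - s ≤ 2 * ε := by
    linarith [min_le_right b (r + ε), (abs_lt.1 hsr).1]
  have hmem : ∀ t ∈ Icc s b', t ∈ Icc a b ∧ |t - r| < δ₁ := fun t ht ↦
    ⟨⟨hs.1.trans ht.1, ht.2.trans (min_le_left _ _)⟩, abs_lt.2
      ⟨by linarith [ht.1, (abs_lt.1 hsr).1], by linarith [ht.2.trans (min_le_right b (r + ε))]⟩⟩
  have hX' : ∀ s' ∈ Icc s b', ∀ t ∈ Icc s b', ‖X t - X s'‖ ≤ H * |t - s'| ^ α := fun s' hs' t ht ↦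
    h₁ s' (hmem s' hs').1 t (hmem t ht).1 (hmem s' hs').2 (hmem t ht).2
  have hpow : (b' - s) ^ α ≤ (2 * ε) ^ α :=
    Real.rpow_le_rpow (sub_nonneg.2 hsb) hlen (by linarith)
  obtain ⟨Y, hY0, hY⟩ := exists_young_solution (α := α) (H := H) (B := B) (L₁ := 0) (L₂ := L) (K := K)
    (h := fun _ ↦ f) (X := X) (by linarith) hsb hH hB le_rfl hL hK0 hX'
    (fun _ _ ↦ hfB) (fun s' _ t _ z z' ↦ by
      have := hfL z z'
      rwa [zero_mul, zero_add])
    (by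
      have h5 : 1 - (2 : ℝ) ^ (1 - 2 * α) ≠ 0 := by linarith
      have h6 : K * (b' - s) ^ α ≤ 1 := (mul_le_mul_of_nonneg_left hpow hK0).trans e1.le
      have h7 : 2 * H * (L * (2 * B * H + 1)) = K * (1 - 2 ^ (1 - 2 * α)) := by
        rw [hKdef]
        field_simp
      have h8 : 2 * H * (0 + L * (2 * B * H + K * (b' - s) ^ α))
          ≤ 2 * H * (L * (2 * B * H + 1)) := by
        rw [zero_add]
        gcongr
      linarith) q
  have hYle : ∀ s' ∈ Icc s b', ∀ t ∈ Icc s b', s' ≤ t →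
      ‖Y t - Y s'‖ ≤ (B * H + 1) * |t - s'| ^ α := by
    intro s' hs' t ht hst
    have d0 : 0 ≤ t - s' := sub_nonneg.2 hst
    have h9 : (t - s') ^ α ≤ (2 * ε) ^ α :=
      Real.rpow_le_rpow d0 (by linarith [ht.2, hs'.1]) (by linarith)
    have h10 : K * (t - s') ^ (2 * α) ≤ 1 * (t - s') ^ α := by
      rw [rpow_two_mul_eq d0, ← mul_assoc]
      gcongr
      exact (mul_le_mul_of_nonneg_left h9 hK0).trans e1.le
    have h11 : ‖f (Y s') (X t - X s')‖ ≤ B * (H * (t - s') ^ α) := by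
      refine (ContinuousLinearMap.le_opNorm _ _).trans
        (mul_le_mul (hfB _) ?_ (norm_nonneg _) hB)
      have := hX' s' hs' t ht
      rwa [abs_of_nonneg d0] at this
    calc ‖Y t - Y s'‖ = ‖(Y t - Y s' - f (Y s') (X t - X s')) + f (Y s') (X t - X s')‖ := by
          rw [sub_add_cancel]
      _ ≤ K * (t - s') ^ (2 * α) + B * (H * (t - s') ^ α) :=
          norm_add_le_of_le (hY s' hs' t ht hst) h11
      _ ≤ _ := by rw [abs_of_nonneg d0]; linarith
  have hYabs : ∀ s' ∈ Icc s b', ∀ t ∈ Icc s b', ‖Y t - Y s'‖ ≤ (B * H + 1) * |t - s'| ^ α := by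
    intro s' hs' t ht
    rcases le_total s' t with h' | h'
    · exact hYle s' hs' t ht h'
    · rw [norm_sub_rev, abs_sub_comm]
      exact hYle t ht s' hs' h'
  have hYball : ∀ t ∈ Icc s b', Y t ∈ Metric.ball z₀ ρ := by
    intro t ht
    have h12 := hYabs s (left_mem_Icc.2 hsb) t ht
    have h13 : |t - s| ^ α ≤ (2 * ε) ^ α :=
      Real.rpow_le_rpow (abs_nonneg _)
        (by rw [abs_of_nonneg (sub_nonneg.2 ht.1)]; linarith [ht.2]) (by linarith)
    have h14 : (B * H + 1) * |t - s| ^ α ≤ (B * H + 1) * (2 * ε) ^ α := by gcongr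
    rw [hY0] at h12
    rw [Metric.mem_ball, dist_eq_norm] at hq ⊢
    calc ‖Y t - z₀‖ = ‖(Y t - q) + (q - z₀)‖ := by rw [sub_add_sub_cancel]
      _ ≤ ‖Y t - q‖ + ‖q - z₀‖ := norm_add_le _ _
      _ < ρ := by linarith
  refine ⟨Y, hY0, fun t ht ↦ (hball _ (hYball t ht)).2, fun r' hr' ↦ ?_⟩
  have nY : NearO α (𝓝[Icc s b'] r') (fun s t ↦ Y t - Y s) :=
    nearO_nhdsWithin_iff.2 ⟨B * H + 1, by positivity, 1, one_pos, fun s' hs' t ht _ _ ↦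
      hYabs s' hs' t ht⟩
  refine ⟨nY, NearO.congr (p := fun t ↦ t ∈ Icc s b') (g := fun s t ↦ Y t - Y s - f (Y s) (X t - X s))
    ?_ self_mem_nhdsWithin fun s' t hs' _ ↦ by simp only [(hball _ (hYball s' hs')).1]⟩
  refine nearO_incr_of_le (C := K) one_pos (fun s' hs' t ht _ _ hst ↦ ?_)
    (A := fun s ↦ f (Y s)) (nearO_nhdsWithin_iff.2 ⟨H, hH, 1, one_pos, fun s' hs' t ht _ _ ↦
      hX' s' hs' t ht⟩) (nearO_nhdsWithin_iff.2 ⟨L * (B * H + 1), by positivity, 1, one_pos,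
        fun s' hs' t ht _ _ ↦ (hfL _ _).trans ?_⟩)
  · rw [abs_of_nonneg (sub_nonneg.2 hst)]
    exact hY s' hs' t ht hst
  · rw [mul_assoc]
    exact mul_le_mul_of_nonneg_left (hYabs s' hs' t ht) hL

/-- Local uniqueness for the Young equation. With `Q` the defect of the difference of two solutions,
a bound `‖Q s t‖ ≤ D |t - s| ^ (2 * α)` on a short interval improves to one with `κ * D`, where
`κ < 1`: split at the midpoint and estimate the cross term by the four-point inequality. -/
theorem young_solution_eventually_eq (hα : 1 / 2 < α) {h : E → V →L[ℝ] E} {z : E}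
    (hh : ContDiffAt ℝ 2 h z) {J : Set ℝ} (hJ : J.OrdConnected) {r : ℝ} (hr : r ∈ J) {X : ℝ → V}
    {Y Y' : ℝ → E} (hX : NearO α (𝓝[J] r) (fun s t ↦ X t - X s))
    (hY : NearO α (𝓝[J] r) (fun s t ↦ Y t - Y s)) (hY' : NearO α (𝓝[J] r) (fun s t ↦ Y' t - Y' s))
    (hYz : Tendsto Y (𝓝[J] r) (𝓝 z)) (hYz' : Tendsto Y' (𝓝[J] r) (𝓝 z))
    (hs : NearO (2 * α) (𝓝[J] r) (fun s t ↦ Y t - Y s - h (Y s) (X t - X s)))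
    (hs' : NearO (2 * α) (𝓝[J] r) (fun s t ↦ Y' t - Y' s - h (Y' s) (X t - X s)))
    (h0 : Y r = Y' r) : ∀ᶠ t in 𝓝[J] r, Y t = Y' t := by
  have hρ := two_rpow_lt_one hα
  have hρ' : (0 : ℝ) < 2 ^ (1 - 2 * α) := by positivity
  obtain ⟨L, hL, ρ, hρ0, h4⟩ := exists_bound_four_point hh
  obtain ⟨H, hH, δ₁, hδ₁, b₁⟩ := nearO_nhdsWithin_iff.1 hX
  obtain ⟨C₂, hC₂, δ₂, hδ₂, b₂⟩ := nearO_nhdsWithin_iff.1 hY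
  obtain ⟨C₃, hC₃, δ₃, hδ₃, b₃⟩ := nearO_nhdsWithin_iff.1 hY'
  obtain ⟨D₀, hD₀, δ₄, hδ₄, b₄⟩ := nearO_nhdsWithin_iff.1 (hs.sub hs')
  obtain ⟨δ₅, hδ₅, b₅⟩ := Metric.eventually_nhds_iff_ball.1 (eventually_nhdsWithin_iff.1
    ((hYz.eventually (Metric.ball_mem_nhds z hρ0)).and
      (hYz'.eventually (Metric.ball_mem_nhds z hρ0))))
  have hlim := tendsto_two_mul_rpow (α := α) (by linarith)
  have ev : ∀ᶠ δ in 𝓝[>] (0 : ℝ), 2 ^ (1 - 2 * α) + L * ((2 * δ) ^ α +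
      L * H * ((2 * δ) ^ α * (2 * δ) ^ α) + (C₂ + C₃) * ((2 * δ) ^ α * (2 * δ) ^ α)) * H < 1 := by
    have := ((((hlim.add ((hlim.mul hlim).const_mul (L * H))).add
      ((hlim.mul hlim).const_mul (C₂ + C₃))).const_mul L).mul_const H).const_add
      ((2 : ℝ) ^ (1 - 2 * α))
    simp only [mul_zero, add_zero, zero_mul] at this
    exact this.eventually_lt_const hρ
  obtain ⟨δ, ⟨hκ, hδlt⟩, hδ⟩ := ((ev.and (mem_nhdsWithin_of_mem_nhds (Iio_mem_nhds
    (lt_min (lt_min (lt_min hδ₁ hδ₂) (lt_min hδ₃ hδ₄)) hδ₅)))).and self_mem_nhdsWithin).exists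
  simp only [lt_min_iff] at hδlt
  obtain ⟨⟨⟨l₁, l₂⟩, l₃, l₄⟩, l₅⟩ := hδlt
  set η := (2 * δ) ^ α with hη
  have hη0 : 0 ≤ η := by positivity
  set κ := 2 ^ (1 - 2 * α) + L * (η + L * H * (η * η) + (C₂ + C₃) * (η * η)) * H with hκdef
  have hκ0 : 0 ≤ κ := by positivity
  set S : Set ℝ := J ∩ Metric.ball r δ with hS
  have hSJ : ∀ s ∈ S, s ∈ J := fun s h ↦ h.1
  have hSr : ∀ s ∈ S, |s - r| < δ := fun s h ↦ by simpa [Real.dist_eq] using h.2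
  have hrS : r ∈ S := ⟨hr, Metric.mem_ball_self hδ⟩
  have hSord : S.OrdConnected := hJ.inter (by rw [Real.ball_eq_Ioo]; exact ordConnected_Ioo)
  have hSη : ∀ s ∈ S, ∀ t ∈ S, |t - s| ^ α ≤ η := by
    intro s hs t ht
    refine Real.rpow_le_rpow (abs_nonneg _) ?_ (by linarith)
    have h1 := abs_lt.1 (hSr s hs)
    have h2 := abs_lt.1 (hSr t ht)
    exact abs_le.2 ⟨by linarith, by linarith⟩
  have hball : ∀ s ∈ S, Y s ∈ Metric.ball z ρ ∧ Y' s ∈ Metric.ball z ρ := fun s hs ↦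
    b₅ s (Metric.ball_subset_ball l₅.le hs.2) hs.1
  have bX : ∀ s ∈ S, ∀ t ∈ S, ‖X t - X s‖ ≤ H * |t - s| ^ α := fun s hs t ht ↦
    b₁ s hs.1 t ht.1 ((hSr s hs).trans l₁) ((hSr t ht).trans l₁)
  have bY : ∀ s ∈ S, ∀ t ∈ S, ‖Y t - Y s‖ ≤ C₂ * |t - s| ^ α := fun s hs t ht ↦
    b₂ s hs.1 t ht.1 ((hSr s hs).trans l₂) ((hSr t ht).trans l₂)
  have bY' : ∀ s ∈ S, ∀ t ∈ S, ‖Y' t - Y' s‖ ≤ C₃ * |t - s| ^ α := fun s hs t ht ↦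
    b₃ s hs.1 t ht.1 ((hSr s hs).trans l₃) ((hSr t ht).trans l₃)
  set w : ℝ → E := fun t ↦ Y t - Y' t with hw
  set G : ℝ → V →L[ℝ] E := fun s ↦ h (Y s) - h (Y' s) with hG
  have hwr : w r = 0 := sub_eq_zero.2 h0
  have hGr : G r = 0 := by simp [hG, h0]
  have hGw : ∀ s ∈ S, ‖G s‖ ≤ L * ‖w s‖ := by
    intro s hs
    have := h4 _ (hball s hs).1 _ (hball s hs).2 _ (hball s hs).1 _ (hball s hs).1
    simpa using this
  set Q : ℝ → ℝ → E := fun s t ↦ w t - w s - G s (X t - X s) with hQ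
  have hQr : ∀ t, Q r t = w t := fun t ↦ by simp [hQ, hwr, hGr]
  have step : ∀ D, 0 ≤ D → (∀ s ∈ S, ∀ t ∈ S, ‖Q s t‖ ≤ D * |t - s| ^ (2 * α)) →
      ∀ s ∈ S, ∀ t ∈ S, ‖Q s t‖ ≤ κ * D * |t - s| ^ (2 * α) := by
    intro D hD hQD s hs t ht
    have wbd : ∀ t ∈ S, ‖w t‖ ≤ D * (η * η) := by
      intro t ht
      have := hQD r hrS t ht
      rw [hQr, rpow_two_mul_eq (abs_nonneg _)] at this
      refine this.trans ?_
      have := hSη r hrS t ht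
      gcongr
    set m := (s + t) / 2 with hm
    have hmS : m ∈ S := by
      rcases le_total s t with h' | h'
      · exact hSord.out hs ht ⟨by linarith, by linarith⟩
      · exact hSord.out ht hs ⟨by linarith, by linarith⟩
    have d1 : |m - s| = |t - s| / 2 := by
      rw [show m - s = (t - s) / 2 by rw [hm]; ring, abs_div, abs_two]
    have d2 : |t - m| = |t - s| / 2 := by
      rw [show t - m = (t - s) / 2 by rw [hm]; ring, abs_div, abs_two]
    set d := |t - s| with hd
    have hd0 : 0 ≤ d := abs_nonneg _
    have dhalf : (d / 2) ^ α ≤ d ^ α := Real.rpow_le_rpow (by linarith) (by linarith) (by linarith)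
    have dη : d ^ α ≤ η := hSη s hs t ht
    have dα : 0 ≤ d ^ α := by positivity
    have winc : ‖w m - w s‖ ≤ D * (η + L * H * (η * η)) * d ^ α := by
      have e : w m - w s = Q s m + G s (X m - X s) := by simp [hQ]
      have e1 : ‖Q s m‖ ≤ D * (η * d ^ α) := by
        refine (hQD s hs m hmS).trans ?_
        rw [d1, rpow_two_mul_eq (by linarith)]
        have := dhalf.trans dη
        gcongr
      have e2 : ‖G s (X m - X s)‖ ≤ L * (D * (η * η)) * (H * d ^ α) := by
        refine (ContinuousLinearMap.le_opNorm _ _).trans ?_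
        refine mul_le_mul ((hGw s hs).trans ?_) ((bX s hs m hmS).trans ?_) (norm_nonneg _)
          (by positivity)
        · have := wbd s hs
          gcongr
        · rw [d1]
          gcongr
      rw [e]
      refine (norm_add_le_of_le e1 e2).trans (le_of_eq ?_)
      ring
    have Ginc : ‖G m - G s‖ ≤ D * (L * (η + L * H * (η * η) + (C₂ + C₃) * (η * η))) * d ^ α := by
      have e1 := h4 _ (hball m hmS).1 _ (hball m hmS).2 _ (hball s hs).1 _ (hball s hs).2
      have e2 : ‖Y m - Y s‖ + ‖Y' m - Y' s‖ ≤ (C₂ + C₃) * d ^ α := by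
        have f1 := bY s hs m hmS
        have f2 := bY' s hs m hmS
        rw [d1] at f1 f2
        have f3 := mul_le_mul_of_nonneg_left dhalf hC₂
        have f4 := mul_le_mul_of_nonneg_left dhalf hC₃
        linarith
      refine e1.trans ?_
      have e3 : L * ‖w m - w s‖ ≤ L * (D * (η + L * H * (η * η)) * d ^ α) := by gcongr
      have e4 : L * (‖Y m - Y s‖ + ‖Y' m - Y' s‖) * ‖w s‖
          ≤ L * ((C₂ + C₃) * d ^ α) * (D * (η * η)) := by
        have := wbd s hs
        gcongr
      refine (add_le_add e3 e4).trans (le_of_eq ?_)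
      ring
    have split : Q s t = Q s m + Q m t + (G m - G s) (X t - X m) := by
      simp only [hQ, map_sub, _root_.sub_apply]
      abel
    have e3 : ‖(G m - G s) (X t - X m)‖
        ≤ D * (L * (η + L * H * (η * η) + (C₂ + C₃) * (η * η))) * d ^ α * (H * d ^ α) := by
      refine (ContinuousLinearMap.le_opNorm _ _).trans ?_
      refine mul_le_mul Ginc ((bX m hmS t ht).trans ?_) (norm_nonneg _) (by positivity)
      rw [d2]
      gcongr
    have e1 := hQD s hs m hmS
    have e2 := hQD m hmS t ht
    rw [d1] at e1
    rw [d2] at e2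
    rw [split]
    refine (norm_add_le_of_le (norm_add_le_of_le e1 e2) e3).trans (le_of_eq ?_)
    have e4 := two_mul_half_rpow (α := α) hd0
    have e5 := rpow_two_mul_eq (α := α) hd0
    calc _ = D * (2 * (d / 2) ^ (2 * α)) + D * (L * (η + L * H * (η * η) + (C₂ + C₃) * (η * η)))
            * d ^ α * (H * d ^ α) := by ring
      _ = _ := by rw [e4, e5, hκdef]; ring
  have iter : ∀ n : ℕ, ∀ s ∈ S, ∀ t ∈ S, ‖Q s t‖ ≤ κ ^ n * D₀ * |t - s| ^ (2 * α) := by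
    intro n
    induction n with
    | zero =>
      intro s hs t ht
      have := b₄ s hs.1 t ht.1 ((hSr s hs).trans l₄) ((hSr t ht).trans l₄)
      rw [pow_zero, one_mul]
      convert this using 2
      simp only [hQ, hw, hG, _root_.sub_apply]
      abel
    | succ n ih =>
      have := step _ (by positivity) ih
      rwa [← mul_assoc, ← pow_succ'] at this
  have hmemS : S ∈ 𝓝[J] r := inter_mem self_mem_nhdsWithin
    (mem_nhdsWithin_of_mem_nhds (Metric.ball_mem_nhds r hδ))
  filter_upwards [hmemS] with t ht
  have hl : Tendsto (fun n : ℕ ↦ κ ^ n * D₀ * |t - r| ^ (2 * α)) atTop (𝓝 (0 * D₀ * |t - r| ^ (2 * α))) :=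
    ((tendsto_pow_atTop_nhds_zero_of_lt_one hκ0 hκ).mul_const _).mul_const _
  have hle := ge_of_tendsto' hl fun n ↦ iter n r hrS t ht
  rw [hQr, zero_mul, zero_mul] at hle
  exact sub_eq_zero.1 (norm_le_zero_iff.1 hle)

end YoungEquation

section Stieltjes

variable {E F : Type*} [NormedAddCommGroup E] [NormedSpace ℝ E]
  [NormedAddCommGroup F] [NormedSpace ℝ F] {α : ℝ}

theorem HasStieltjesIntegral.unique {A : ℝ → E →L[ℝ] F} {y : ℝ → E} {a b : ℝ} (hab : a ≤ b) {v v' : F}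
    (h : HasStieltjesIntegral A y a b v) (h' : HasStieltjesIntegral A y a b v') : v = v' := by
  by_contra hne
  have hpos : 0 < ‖v - v'‖ / 2 := by
    have := norm_pos_iff.2 (sub_ne_zero.2 hne)
    positivity
  obtain ⟨δ, hδ, h1⟩ := h _ hpos
  obtain ⟨δ', hδ', h2⟩ := h' _ hpos
  obtain ⟨n, hn⟩ := exists_nat_gt ((b - a) / min δ δ')
  have hn0 : (0 : ℝ) < n :=
    lt_of_le_of_lt (div_nonneg (by linarith) (lt_min hδ hδ').le) hn
  let s : ℕ → ℝ := fun i ↦ a + i * ((b - a) / n)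
  have hstep : ∀ i, s (i + 1) - s i = (b - a) / n := fun i ↦ by
    simp only [s]
    push_cast
    ring
  have hsmall : (b - a) / n < min δ δ' := by
    rw [div_lt_iff₀ (lt_min hδ hδ')] at hn
    rwa [div_lt_iff₀ hn0, mul_comm]
  have hs0 : s 0 = a := by simp [s]
  have hsn : s n = b := by
    simp only [s]
    field_simp
    ring
  have hnn : 0 ≤ (b - a) / n := div_nonneg (by linarith) hn0.le
  have hp : ∀ i < n, s i ≤ s i ∧ s i ≤ s (i + 1) ∧ s (i + 1) - s i < min δ δ' := fun i _ ↦
    ⟨le_rfl, by linarith [hstep i], by rw [hstep]; exact hsmall⟩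
  have k1 := h1 n s s hs0 hsn fun i hi ↦
    ⟨(hp i hi).1, (hp i hi).2.1, (hp i hi).2.2.trans_le (min_le_left _ _)⟩
  have k2 := h2 n s s hs0 hsn fun i hi ↦
    ⟨(hp i hi).1, (hp i hi).2.1, (hp i hi).2.2.trans_le (min_le_right _ _)⟩
  have := norm_sub_le_norm_sub_add_norm_sub v
    (∑ i ∈ Finset.range n, A (s i) (y (s (i + 1)) - y (s i))) v'
  rw [norm_sub_rev] at k1
  linarith

/-- If the increments of `I` are `A_s (Y_t - Y_s)` up to order `2α > 1`, then the Riemann-Stieltjes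
integral of `A` against `Y` exists and is the increment of `I`. -/
theorem hasStieltjesIntegral_of_nearO (hα : 1 / 2 < α) {a b : ℝ} {A : ℝ → E →L[ℝ] F}
    {Y : ℝ → E} {I : ℝ → F}
    (hY : ∀ r ∈ Icc a b, NearO α (𝓝[Icc a b] r) (fun s t ↦ Y t - Y s))
    (hA : ∀ r ∈ Icc a b, NearO α (𝓝[Icc a b] r) (fun s t ↦ A t - A s))
    (hI : ∀ r ∈ Icc a b, NearO (2 * α) (𝓝[Icc a b] r) (fun s t ↦ I t - I s - A s (Y t - Y s))) :
    HasStieltjesIntegral A Y a b (I b - I a) := by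
  obtain ⟨C₁, hC₁, δ₁, hδ₁, h₁⟩ := exists_uniform_of_nearO isCompact_Icc hY
  obtain ⟨C₂, hC₂, δ₂, hδ₂, h₂⟩ := exists_uniform_of_nearO isCompact_Icc hA
  obtain ⟨C₃, hC₃, δ₃, hδ₃, h₃⟩ := exists_uniform_of_nearO isCompact_Icc hI
  intro ε hε
  set C := C₃ + C₂ * C₁ with hC
  have hC0 : 0 ≤ C := by positivity
  have hlim : Tendsto (fun δ : ℝ ↦ C * |b - a| * δ ^ (2 * α - 1)) (𝓝[>] 0) (𝓝 0) := by
    have : Tendsto (fun δ : ℝ ↦ C * |b - a| * δ ^ (2 * α - 1)) (𝓝 0)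
        (𝓝 (C * |b - a| * 0 ^ (2 * α - 1))) :=
      (continuous_const.mul (continuous_id.rpow_const
        (fun _ ↦ Or.inr (by linarith)))).tendsto 0
    rw [Real.zero_rpow (by linarith), mul_zero] at this
    exact this.mono_left nhdsWithin_le_nhds
  obtain ⟨δ, ⟨hδε, hδlt⟩, hδ⟩ := (((hlim.eventually_lt_const hε).and (mem_nhdsWithin_of_mem_nhds
    (Iio_mem_nhds (lt_min (lt_min hδ₁ hδ₂) hδ₃)))).and self_mem_nhdsWithin).exists
  simp only [lt_min_iff] at hδlt
  refine ⟨δ, hδ, fun n s ξ hs0 hsn hp ↦ ?_⟩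
  have hmono : ∀ i j, i ≤ j → j ≤ n → s i ≤ s j := by
    intro i j hij
    induction j, hij using Nat.le_induction with
    | base => exact fun _ ↦ le_rfl
    | succ j hij ih => exact fun hj ↦ (ih (by omega)).trans ((hp j hj).1.trans (hp j hj).2.1)
  have hmem : ∀ i ≤ n, s i ∈ Icc a b := fun i hi ↦
    ⟨hs0 ▸ hmono 0 i (Nat.zero_le _) hi, hsn ▸ hmono i n hi le_rfl⟩
  have hab : a ≤ b := (hmem 0 (Nat.zero_le _)).1.trans (hmem 0 (Nat.zero_le _)).2
  have term : ∀ i ∈ Finset.range n, ‖A (ξ i) (Y (s (i + 1)) - Y (s i)) - (I (s (i + 1)) - I (s i))‖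
      ≤ C * δ ^ (2 * α - 1) * (s (i + 1) - s i) := by
    intro i hi
    rw [Finset.mem_range] at hi
    obtain ⟨p1, p2, p3⟩ := hp i hi
    have m1 := hmem i hi.le
    have m2 := hmem (i + 1) hi
    have m3 : ξ i ∈ Icc a b := ⟨m1.1.trans p1, p2.trans m2.2⟩
    have d0 : 0 ≤ s (i + 1) - s i := by linarith
    have a1 : |s (i + 1) - s i| = s (i + 1) - s i := abs_of_nonneg d0
    have a2 : |ξ i - s i| = ξ i - s i := abs_of_nonneg (by linarith)
    set d := s (i + 1) - s i with hd
    have e1 := h₃ _ m1 _ m2 (by rw [a1]; linarith)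
    rw [a1] at e1
    have e2 : ‖(A (ξ i) - A (s i)) (Y (s (i + 1)) - Y (s i))‖ ≤ C₂ * d ^ α * (C₁ * d ^ α) := by
      refine (ContinuousLinearMap.le_opNorm _ _).trans
        (mul_le_mul ((h₂ _ m1 _ m3 (by rw [a2]; linarith)).trans ?_) ?_ (norm_nonneg _)
          (by positivity))
      · rw [a2]
        have : (ξ i - s i) ^ α ≤ d ^ α :=
          Real.rpow_le_rpow (by linarith) (by linarith) (by linarith)
        gcongr
      · have := h₁ _ m1 _ m2 (by rw [a1]; linarith)
        rwa [a1] at this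
    have e : A (ξ i) (Y (s (i + 1)) - Y (s i)) - (I (s (i + 1)) - I (s i))
        = (A (ξ i) - A (s i)) (Y (s (i + 1)) - Y (s i))
          - (I (s (i + 1)) - I (s i) - A (s i) (Y (s (i + 1)) - Y (s i))) := by
      simp only [map_sub, _root_.sub_apply]
      abel
    rw [e]
    refine (norm_sub_le_of_le e2 e1).trans ?_
    have e3 : d ^ (2 * α) ≤ δ ^ (2 * α - 1) * d := by
      rcases eq_or_lt_of_le d0 with h0 | h0
      · rw [← h0, Real.zero_rpow (by linarith), mul_zero]
      · have : d ^ (2 * α) = d ^ (2 * α - 1) * d := by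
          rw [← Real.rpow_add_one h0.ne', sub_add_cancel]
        rw [this]
        gcongr
        linarith
    have e4 := rpow_two_mul_eq (α := α) d0
    calc _ = C * d ^ (2 * α) := by rw [hC, e4]; ring
      _ ≤ C * (δ ^ (2 * α - 1) * d) := by gcongr
      _ = _ := by ring
  have tel : I b - I a = ∑ i ∈ Finset.range n, (I (s (i + 1)) - I (s i)) := by
    rw [Finset.sum_range_sub (fun i ↦ I (s i)), hs0, hsn]
  rw [tel, ← Finset.sum_sub_distrib]
  refine (norm_sum_le_of_le _ term).trans_lt ?_
  rw [← Finset.mul_sum, Finset.sum_range_sub s, hs0, hsn]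
  rw [abs_of_nonneg (sub_nonneg.2 hab)] at hδε
  linarith

end Stieltjes

/-! ### Primitives of forms along Hölder paths -/

section FormInChart

variable {E : Type*} [NormedAddCommGroup E] [NormedSpace ℝ E]
  {F : Type*} [NormedAddCommGroup F] [NormedSpace ℝ F]
  {N : Type*} [TopologicalSpace N] [ChartedSpace E N]
  {β : ∀ p : N, TangentSpace 𝓘(ℝ, E) p →L[ℝ] F}

theorem contDiffAt_transition {e e' : OpenPartialHomeomorph N E}
    (he : e ∈ IsManifold.maximalAtlas 𝓘(ℝ, E) ∞ N) (he' : e' ∈ IsManifold.maximalAtlas 𝓘(ℝ, E) ∞ N)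
    {z : E} (hz : z ∈ e.target) (hz' : e.symm z ∈ e'.source) :
    ContDiffAt ℝ ∞ (e' ∘ e.symm) z :=
  contMDiffAt_iff_contDiffAt.1 ((contMDiffAt_of_mem_maximalAtlas he' hz').comp z
    (contMDiffAt_symm_of_mem_maximalAtlas he hz))

/-- The transformation rule of the coordinate expression of a form under a change of charts. -/
theorem formInChart_transition {e e' : OpenPartialHomeomorph N E}
    (he : e ∈ IsManifold.maximalAtlas 𝓘(ℝ, E) ∞ N) (he' : e' ∈ IsManifold.maximalAtlas 𝓘(ℝ, E) ∞ N)
    {z : E} (hz : z ∈ e.target) (hz' : e.symm z ∈ e'.source) (v : E) :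
    formInChart e β z v = formInChart e' β (e' (e.symm z)) (fderiv ℝ (e' ∘ e.symm) z v) := by
  have hinv : e'.symm (e' (e.symm z)) = e.symm z := e'.left_inv hz'
  have h1 : MDifferentiableAt 𝓘(ℝ, E) 𝓘(ℝ, E) e'.symm ((e' ∘ e.symm) z) :=
    (contMDiffAt_symm_of_mem_maximalAtlas he' (e'.map_source hz')).mdifferentiableAt (by simp)
  have h2 : MDifferentiableAt 𝓘(ℝ, E) 𝓘(ℝ, E) (e' ∘ e.symm) z :=
    ((contDiffAt_transition he he' hz hz').differentiableAt (by simp)).mdifferentiableAt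
  have h3 : e'.symm ∘ (e' ∘ e.symm) =ᶠ[𝓝 z] e.symm := by
    filter_upwards [(e.continuousAt_symm hz).preimage_mem_nhds (e'.open_source.mem_nhds hz')]
      with w hw using e'.left_inv hw
  have h4 : mfderiv 𝓘(ℝ, E) 𝓘(ℝ, E) e.symm z v
      = (mfderiv 𝓘(ℝ, E) 𝓘(ℝ, E) e'.symm (e' (e.symm z)) (fderiv ℝ (e' ∘ e.symm) z v) : E) := by
    have h5 := mfderiv_comp z h1 h2
    rw [mfderiv_eq_fderiv] at h5
    have h6 := h3.mfderiv_eq (I := 𝓘(ℝ, E)) (I' := 𝓘(ℝ, E))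
    have h7 : mfderiv 𝓘(ℝ, E) 𝓘(ℝ, E) (e'.symm ∘ (e' ∘ e.symm)) z v
        = (mfderiv 𝓘(ℝ, E) 𝓘(ℝ, E) e.symm z v : E) := by
      rw [h6]
      rfl
    rw [← h7, h5]
    rfl
  have key : ∀ p q : N, p = q → ∀ w : E, β p w = β q w := by
    rintro p _ rfl w
    rfl
  change β (e.symm z) (mfderiv 𝓘(ℝ, E) 𝓘(ℝ, E) e.symm z v) = β (e'.symm (e' (e.symm z)))
    (mfderiv 𝓘(ℝ, E) 𝓘(ℝ, E) e'.symm (e' (e.symm z)) (fderiv ℝ (e' ∘ e.symm) z v))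
  rw [h4]
  exact key _ _ hinv.symm _

variable [IsManifold 𝓘(ℝ, E) ∞ N]

theorem contDiffAt_formInChart [FiniteDimensional ℝ E] (hβ : IsSmoothOneForm β)
    {e : OpenPartialHomeomorph N E} (he : e ∈ IsManifold.maximalAtlas 𝓘(ℝ, E) ∞ N) {z : E}
    (hz : z ∈ e.target) : ContDiffAt ℝ ∞ (formInChart e β) z := by
  refine ContDiffOn.contDiffAt (s := e.target) (contDiffOn_clm_apply.2 fun v ↦ ?_)
    (e.open_target.mem_nhds hz)
  have h1 : ContMDiffOn 𝓘(ℝ, E) 𝓘(ℝ, E).tangent ∞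
      (fun z : E ↦ (⟨z, v⟩ : TangentBundle 𝓘(ℝ, E) E)) e.target :=
    contMDiffOn_vectorSpace_iff_contDiffOn.2 contDiffOn_const
  have h2 := (contMDiffOn_symm_of_mem_maximalAtlas he).contMDiffOn_tangentMapWithin
    (m := ∞) (by simp) e.open_target.uniqueMDiffOn
  have h3 := hβ.comp_contMDiffOn (h2.comp h1 fun w hw ↦ hw)
  rw [contMDiffOn_iff_contDiffOn] at h3
  refine h3.congr fun w hw ↦ ?_
  simp only [Function.comp_apply, tangentMapWithin, formInChart]
  rw [mfderivWithin_of_isOpen e.open_target hw]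
  rfl

end FormInChart

theorem eventually_mem_source {E N : Type*} [TopologicalSpace E] [TopologicalSpace N] {y : ℝ → N}
    {J : Set ℝ} {r : ℝ} {e : OpenPartialHomeomorph N E} (hc : ContinuousWithinAt y J r)
    (hr : y r ∈ e.source) : ∀ᶠ t in 𝓝[J] r, y t ∈ e.source :=
  hc.eventually (e.open_source.mem_nhds hr)

theorem tendsto_chart {E N : Type*} [TopologicalSpace E] [TopologicalSpace N] {y : ℝ → N}
    {J : Set ℝ} {r : ℝ} {e : OpenPartialHomeomorph N E} (hc : ContinuousWithinAt y J r)
    (hr : y r ∈ e.source) : Tendsto (fun t ↦ e (y t)) (𝓝[J] r) (𝓝 (e (y r))) :=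
  (e.continuousAt hr).tendsto.comp hc

section HolderPath

variable {E : Type*} [NormedAddCommGroup E] {α : ℝ}
  {N : Type*} [TopologicalSpace N] [ChartedSpace E N] {y : ℝ → N} {J J' : Set ℝ}

theorem isHolderPath_iff : IsHolderPath E α J y ↔ ContinuousOn y J ∧ ∀ r ∈ J,
    NearO α (𝓝[J] r) (fun s t ↦ chartAt E (y r) (y t) - chartAt E (y r) (y s)) := by
  refine and_congr_right fun hc ↦ forall₂_congr fun r hr ↦ ?_
  rw [nearO_nhdsWithin_iff]
  constructor
  · rintro ⟨C, δ, hδ, h⟩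
    refine ⟨|C|, abs_nonneg C, δ, hδ, fun s hs t ht hsr htr ↦ (h s hs t ht hsr htr).2.2.trans ?_⟩
    gcongr
    exact le_abs_self C
  · rintro ⟨C, -, δ, hδ, h⟩
    have hev : ∀ᶠ t in 𝓝[J] r, y t ∈ (chartAt E (y r)).source :=
      (hc r hr).eventually ((chartAt E (y r)).open_source.mem_nhds (mem_chart_source E (y r)))
    obtain ⟨δ', hδ', h'⟩ := Metric.eventually_nhds_iff_ball.1 (eventually_nhdsWithin_iff.1 hev)
    have hin : ∀ s ∈ J, |s - r| < min δ δ' → y s ∈ (chartAt E (y r)).source := fun s hs hsr ↦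
      h' s (by rw [Metric.mem_ball, Real.dist_eq]; exact hsr.trans_le (min_le_right _ _)) hs
    exact ⟨C, min δ δ', lt_min hδ hδ', fun s hs t ht hsr htr ↦ ⟨hin s hs hsr, hin t ht htr,
      h s hs t ht (hsr.trans_le (min_le_left _ _)) (htr.trans_le (min_le_left _ _))⟩⟩

theorem IsHolderPath.mono (hy : IsHolderPath E α J y) (h : J' ⊆ J) : IsHolderPath E α J' y := by
  rw [isHolderPath_iff] at hy ⊢
  exact ⟨hy.1.mono h, fun r hr ↦ (hy.2 r (h hr)).mono (nhdsWithin_mono r h)⟩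

end HolderPath

theorem two_le_infty : (2 : WithTop ℕ∞) ≤ ∞ :=
  WithTop.coe_le_coe.2 (le_top (a := (2 : ℕ∞)))

section Primitive

variable {E : Type*} [NormedAddCommGroup E] [NormedSpace ℝ E]
  {F : Type*} [NormedAddCommGroup F] [NormedSpace ℝ F] {α : ℝ}

/-- Estimates to the left and to the right of the time `b` combine to one around `b`. -/
theorem nearO_glue (hα : 0 < α) {a b c : ℝ} (hb : b ∈ Icc a c) {Y : ℝ → E} {I : ℝ → F}
    {A : ℝ → E →L[ℝ] F} (hY : NearO α (𝓝[Icc a c] b) (fun s t ↦ Y t - Y s))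
    (hA : NearO α (𝓝[Icc a c] b) (fun s t ↦ A t - A s))
    (h₁ : NearO (2 * α) (𝓝[Icc a b] b) (fun s t ↦ I t - I s - A s (Y t - Y s)))
    (h₂ : NearO (2 * α) (𝓝[Icc b c] b) (fun s t ↦ I t - I s - A s (Y t - Y s))) :
    NearO (2 * α) (𝓝[Icc a c] b) (fun s t ↦ I t - I s - A s (Y t - Y s)) := by
  obtain ⟨C₁, hC₁, δ₁, hδ₁, b₁⟩ := nearO_nhdsWithin_iff.1 h₁
  obtain ⟨C₂, hC₂, δ₂, hδ₂, b₂⟩ := nearO_nhdsWithin_iff.1 h₂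
  obtain ⟨C₃, hC₃, δ₃, hδ₃, b₃⟩ := nearO_nhdsWithin_iff.1 hY
  obtain ⟨C₄, hC₄, δ₄, hδ₄, b₄⟩ := nearO_nhdsWithin_iff.1 hA
  refine nearO_incr_of_le (C := C₁ + C₂ + C₄ * C₃) (δ := min (min δ₁ δ₂) (min δ₃ δ₄))
    (lt_min (lt_min hδ₁ hδ₂) (lt_min hδ₃ hδ₄)) (fun s hs t ht hsr htr hst ↦ ?_) hY hA
  simp only [lt_min_iff] at hsr htr
  have hp : 0 ≤ |t - s| ^ (2 * α) := by positivity
  have p1 : 0 ≤ C₁ * |t - s| ^ (2 * α) := by positivity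
  have p2 : 0 ≤ C₂ * |t - s| ^ (2 * α) := by positivity
  have p3 : 0 ≤ C₄ * C₃ * |t - s| ^ (2 * α) := by positivity
  rw [add_mul, add_mul]
  rcases le_total t b with htb | htb
  · have := b₁ s ⟨hs.1, hst.trans htb⟩ t ⟨ht.1, htb⟩ hsr.1.1 htr.1.1
    linarith
  rcases le_total b s with hbs | hbs
  · have := b₂ s ⟨hbs, hs.2⟩ t ⟨htb, ht.2⟩ hsr.1.2 htr.1.2
    linarith
  have hbb : ∀ δ, 0 < δ → |b - b| < δ := fun δ hδ ↦ by simpa using hδ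
  have e : I t - I s - A s (Y t - Y s) = (I b - I s - A s (Y b - Y s))
      + (I t - I b - A b (Y t - Y b)) + (A b - A s) (Y t - Y b) := by
    simp only [map_sub, _root_.sub_apply]
    abel
  have d1 : |b - s| ≤ |t - s| := by
    rw [abs_of_nonneg (by linarith), abs_of_nonneg (by linarith)]
    linarith
  have d2 : |t - b| ≤ |t - s| := by
    rw [abs_of_nonneg (by linarith), abs_of_nonneg (by linarith)]
    linarith
  have f1 := b₁ s ⟨hs.1, hbs⟩ b ⟨hb.1, le_rfl⟩ hsr.1.1 (hbb _ hδ₁)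
  have f2 := b₂ b ⟨le_rfl, hb.2⟩ t ⟨htb, ht.2⟩ (hbb _ hδ₂) htr.1.2
  have f3 : ‖(A b - A s) (Y t - Y b)‖ ≤ C₄ * |t - s| ^ α * (C₃ * |t - s| ^ α) := by
    refine (ContinuousLinearMap.le_opNorm _ _).trans (mul_le_mul
      ((b₄ s hs b hb hsr.2.2 (hbb _ hδ₄)).trans ?_)
      ((b₃ b hb t ht (hbb _ hδ₃) htr.2.1).trans ?_) (norm_nonneg _) (by positivity))
    all_goals gcongr
  have f4 : |b - s| ^ (2 * α) ≤ |t - s| ^ (2 * α) := by gcongr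
  have f5 : |t - b| ^ (2 * α) ≤ |t - s| ^ (2 * α) := by gcongr
  have f6 := mul_le_mul_of_nonneg_left f4 hC₁
  have f7 := mul_le_mul_of_nonneg_left f5 hC₂
  rw [e]
  refine norm_add₃_le.trans ?_
  have := rpow_two_mul_eq (α := α) (abs_nonneg (t - s))
  rw [show C₄ * |t - s| ^ α * (C₃ * |t - s| ^ α) = C₄ * C₃ * (|t - s| ^ α * |t - s| ^ α) by ring,
    ← this] at f3
  linarith

variable {N : Type*} [TopologicalSpace N] [ChartedSpace E N]
  {β : ∀ p : N, TangentSpace 𝓘(ℝ, E) p →L[ℝ] F} {y : ℝ → N} {J J' : Set ℝ} {r : ℝ}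

/-- Hölder continuity does not depend on the chart. -/
theorem nearO_chart_change {e e' : OpenPartialHomeomorph N E}
    (he : e ∈ IsManifold.maximalAtlas 𝓘(ℝ, E) ∞ N) (he' : e' ∈ IsManifold.maximalAtlas 𝓘(ℝ, E) ∞ N)
    (hc : ContinuousWithinAt y J r) (hr : y r ∈ e.source) (hr' : y r ∈ e'.source)
    (h : NearO α (𝓝[J] r) (fun s t ↦ e (y t) - e (y s))) :
    NearO α (𝓝[J] r) (fun s t ↦ e' (y t) - e' (y s)) := by
  have ht : ContDiffAt ℝ ∞ (e' ∘ e.symm) (e (y r)) :=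
    contDiffAt_transition he he' (e.map_source hr) (by rwa [e.left_inv hr])
  refine (h.comp_contDiffAt (tendsto_chart hc hr) (ht.of_le two_le_infty)).congr
    (eventually_mem_source hc hr) fun s t hs ht ↦ ?_
  simp only [Function.comp_apply, e.left_inv hs, e.left_inv ht]

/-- Near the time `r`, the function `I` is a primitive of the form `β` along the path `y`: in every
chart its increments are `β(y_s) (y_t - y_s)` up to order `2α`. -/
def IsPrimitiveAt (α : ℝ) (β : ∀ p : N, TangentSpace 𝓘(ℝ, E) p →L[ℝ] F) (y : ℝ → N) (I : ℝ → F)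
    (J : Set ℝ) (r : ℝ) : Prop :=
  ∀ e ∈ IsManifold.maximalAtlas 𝓘(ℝ, E) ∞ N, y r ∈ e.source →
    NearO (2 * α) (𝓝[J] r) (fun s t ↦ I t - I s - formInChart e β (e (y s)) (e (y t) - e (y s)))

theorem IsPrimitiveAt.mono_of_mem {I : ℝ → F} (h : IsPrimitiveAt α β y I J r) (hJ : J ∈ 𝓝[J'] r) :
    IsPrimitiveAt α β y I J' r :=
  fun e he her ↦ (h e he her).mono (nhdsWithin_le_of_mem hJ)

variable [IsManifold 𝓘(ℝ, E) ∞ N]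

theorem IsHolderPath.nearO (hy : IsHolderPath E α J y) {e : OpenPartialHomeomorph N E}
    (he : e ∈ IsManifold.maximalAtlas 𝓘(ℝ, E) ∞ N) (hr : r ∈ J) (her : y r ∈ e.source) :
    NearO α (𝓝[J] r) (fun s t ↦ e (y t) - e (y s)) :=
  nearO_chart_change (IsManifold.chart_mem_maximalAtlas (y r)) he (hy.1 r hr)
    (mem_chart_source E (y r)) her ((isHolderPath_iff.1 hy).2 r hr)

theorem nearO_formInChart [FiniteDimensional ℝ E] (hβ : IsSmoothOneForm β)
    {e : OpenPartialHomeomorph N E} (he : e ∈ IsManifold.maximalAtlas 𝓘(ℝ, E) ∞ N)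
    (hc : ContinuousWithinAt y J r) (her : y r ∈ e.source)
    (h : NearO α (𝓝[J] r) (fun s t ↦ e (y t) - e (y s))) :
    NearO α (𝓝[J] r) (fun s t ↦ formInChart e β (e (y t)) - formInChart e β (e (y s))) :=
  h.comp_contDiffAt (tendsto_chart hc her)
    ((contDiffAt_formInChart hβ he (e.map_source her)).of_le two_le_infty)

/-- To be a primitive can be checked in a single chart: by Taylor's formula, the change of charts
alters `β(y_s) (y_t - y_s)` only by terms of order `2α`. -/
theorem isPrimitiveAt_of_chart [FiniteDimensional ℝ E] (hβ : IsSmoothOneForm β)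
    {e : OpenPartialHomeomorph N E} (he : e ∈ IsManifold.maximalAtlas 𝓘(ℝ, E) ∞ N)
    (hc : ContinuousWithinAt y J r) (her : y r ∈ e.source)
    (hy : NearO α (𝓝[J] r) (fun s t ↦ e (y t) - e (y s))) {I : ℝ → F}
    (h : NearO (2 * α) (𝓝[J] r)
      (fun s t ↦ I t - I s - formInChart e β (e (y s)) (e (y t) - e (y s)))) :
    IsPrimitiveAt α β y I J r := by
  intro e' he' her'
  have hψ : ContDiffAt ℝ ∞ (e' ∘ e.symm) (e (y r)) :=
    contDiffAt_transition he he' (e.map_source her) (by rwa [e.left_inv her])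
  have h1 := nearO_taylor hy (tendsto_chart hc her) (hψ.of_le two_le_infty)
  have hlim := (contDiffAt_formInChart hβ he' (e'.map_source her')).continuousAt.tendsto.comp
    (tendsto_chart hc her')
  have h2 := h1.clm_apply (A := fun s ↦ formInChart e' β (e' (y s)))
    ((hlim.norm.eventually_lt_const (lt_add_one _)).mono fun _ h ↦ h.le)
  refine (h.sub h2).congr ((eventually_mem_source hc her).and (eventually_mem_source hc her'))
    fun s t hs ht ↦ ?_
  have h3 := formInChart_transition (β := β) he he' (e.map_source hs.1)
    (by rw [e.left_inv hs.1]; exact hs.2) (e (y t) - e (y s))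
  rw [e.left_inv hs.1] at h3
  simp only [Function.comp_apply, e.left_inv hs.1, e.left_inv ht.1]
  rw [h3, map_sub _ (e' (y t) - e' (y s))]
  simp only [Function.comp_def]
  abel

/-- Along a Hölder path on a compact interval, every smooth form has a primitive. -/
theorem exists_isPrimitiveAt [FiniteDimensional ℝ E] [FiniteDimensional ℝ F] (hα : 1 / 2 < α)
    (hβ : IsSmoothOneForm β) {a b : ℝ} (hab : a ≤ b) (hy : IsHolderPath E α (Icc a b) y) :
    ∃ I : ℝ → F, ∀ r ∈ Icc a b, IsPrimitiveAt α β y I (Icc a b) r := by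
  have loc : ∀ r : Icc a b, ∃ I : ℝ → F, ∃ U : Set ℝ, IsOpen U ∧ (r : ℝ) ∈ U ∧
      ∀ r' ∈ U ∩ Icc a b, IsPrimitiveAt α β y I (Icc a b) r' := by
    rintro ⟨r, hr⟩
    have he := IsManifold.chart_mem_maximalAtlas (I := 𝓘(ℝ, E)) (n := ∞) (y r)
    have hin := mem_chart_source E (y r)
    have hY := hy.nearO he hr hin
    obtain ⟨I, ε, hε, hI⟩ := exists_local_primitive hα hr hY
      (nearO_formInChart hβ he (hy.1 r hr) hin hY)
    obtain ⟨δ, hδ, hball⟩ := Metric.eventually_nhds_iff_ball.1 (eventually_nhdsWithin_iff.1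
      (eventually_mem_source (hy.1 r hr) hin))
    refine ⟨I, Metric.ball r (min ε δ), Metric.isOpen_ball,
      Metric.mem_ball_self (lt_min hε hδ), fun r' hr' ↦ ?_⟩
    have hsrc := hball r' (Metric.ball_subset_ball (min_le_right _ _) hr'.1) hr'.2
    have hdist : |r' - r| < ε := by
      have := hr'.1
      rw [Metric.mem_ball, Real.dist_eq] at this
      exact this.trans_le (min_le_left _ _)
    exact isPrimitiveAt_of_chart hβ he (hy.1 r' hr'.2) hsrc (hy.nearO he hr'.2 hsrc) (hI r' hdist)
  choose I U hU hrU hI using loc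
  obtain ⟨t, ht0, htm, ⟨n, hn⟩, hsub⟩ := exists_monotone_Icc_subset_open_cover_Icc hab
    (c := fun r : Icc a b ↦ Subtype.val ⁻¹' U r) (fun r ↦ (hU r).preimage continuous_subtype_val)
    (fun r _ ↦ mem_iUnion.2 ⟨r, hrU r⟩)
  have main : ∀ k, ∃ I : ℝ → F, ∀ r ∈ Icc a (t k : ℝ), IsPrimitiveAt α β y I (Icc a (t k)) r := by
    intro k
    induction k with
    | zero =>
      refine ⟨0, fun r _ e _ _ ↦ nearO_nhdsWithin_iff.2 ⟨0, le_rfl, 1, one_pos, ?_⟩⟩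
      rw [ht0, Icc_self]
      rintro s rfl t rfl - -
      simp
    | succ k ih =>
      obtain ⟨I₁, hI₁⟩ := ih
      obtain ⟨i, hi⟩ := hsub k
      set b₀ := (t k : ℝ) with hb₀
      set c₀ := (t (k + 1) : ℝ) with hc₀
      have hbc : b₀ ≤ c₀ := htm k.le_succ
      have hab₀ : a ≤ b₀ := (t k).2.1
      have hcb : c₀ ≤ b := (t (k + 1)).2.2
      have hI₂ : ∀ r ∈ Icc b₀ c₀, IsPrimitiveAt α β y (I i) (Icc a b) r := fun r hr ↦
        hI i r ⟨@hi ⟨r, hab₀.trans hr.1, hr.2.trans hcb⟩ ⟨hr.1, hr.2⟩, hab₀.trans hr.1, hr.2.trans hcb⟩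
      have hy' : IsHolderPath E α (Icc a c₀) y := hy.mono (Icc_subset_Icc_right hcb)
      set I₃ : ℝ → F := fun s ↦ if s ≤ b₀ then I₁ s else I i s - I i b₀ + I₁ b₀ with hI₃
      have hl : ∀ s, s ≤ b₀ → I₃ s = I₁ s := fun s hs ↦ if_pos hs
      have hr : ∀ s, b₀ ≤ s → I₃ s = I i s - I i b₀ + I₁ b₀ := fun s hs ↦ by
        rcases eq_or_lt_of_le hs with rfl | hs
        · simp [hI₃]
        · exact if_neg (not_le.2 hs)
      refine ⟨I₃, fun r hrm e he her ↦ ?_⟩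
      rcases lt_trichotomy r b₀ with hrb | hrb | hrb
      · have hmem : Icc a b₀ ∈ 𝓝[Icc a c₀] r := by
          filter_upwards [self_mem_nhdsWithin, mem_nhdsWithin_of_mem_nhds (Iio_mem_nhds hrb)]
            with s hs hs' using ⟨hs.1, le_of_lt hs'⟩
        refine ((hI₁ r ⟨hrm.1, hrb.le⟩).mono_of_mem hmem e he her).congr
          (mem_nhdsWithin_of_mem_nhds (Iio_mem_nhds hrb)) fun s t hs ht ↦ ?_
        rw [hl s (le_of_lt hs), hl t (le_of_lt ht)]
      · subst hrb
        refine nearO_glue (by linarith) hrm (hy'.nearO he hrm her)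
          (nearO_formInChart hβ he (hy'.1 b₀ hrm) her (hy'.nearO he hrm her)) ?_ ?_
        · refine (hI₁ b₀ ⟨hrm.1, le_rfl⟩ e he her).congr self_mem_nhdsWithin fun s t hs ht ↦ ?_
          rw [hl s hs.2, hl t ht.2]
        · refine ((hI₂ b₀ ⟨le_rfl, hrm.2⟩ e he her).mono (nhdsWithin_mono _
            (Icc_subset_Icc hab₀ hcb))).congr self_mem_nhdsWithin fun s t hs ht ↦ ?_
          rw [hr s hs.1, hr t ht.1]
          abel
      · refine ((hI₂ r ⟨hrb.le, hrm.2⟩ e he her).mono (nhdsWithin_mono _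
          (Icc_subset_Icc_right hcb))).congr
          (mem_nhdsWithin_of_mem_nhds (Ioi_mem_nhds hrb)) fun s t hs ht ↦ ?_
        rw [hr s (le_of_lt hs), hr t (le_of_lt ht)]
        abel
  have := main n
  rwa [hn n le_rfl] at this

theorem hasStieltjesIntegral_of_isPrimitiveAt [FiniteDimensional ℝ E] (hα : 1 / 2 < α)
    (hβ : IsSmoothOneForm β) {e : OpenPartialHomeomorph N E}
    (he : e ∈ IsManifold.maximalAtlas 𝓘(ℝ, E) ∞ N) {a b : ℝ} (hy : IsHolderPath E α (Icc a b) y)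
    (hsrc : ∀ s ∈ Icc a b, y s ∈ e.source) {I : ℝ → F}
    (hI : ∀ r ∈ Icc a b, IsPrimitiveAt α β y I (Icc a b) r) :
    HasStieltjesIntegral (fun s ↦ formInChart e β (e (y s))) (fun s ↦ e (y s)) a b (I b - I a) :=
  hasStieltjesIntegral_of_nearO hα (fun r hr ↦ hy.nearO he hr (hsrc r hr))
    (fun r hr ↦ nearO_formInChart hβ he (hy.1 r hr) (hsrc r hr) (hy.nearO he hr (hsrc r hr)))
    (fun r hr ↦ hI r hr e he (hsrc r hr))

theorem hasFormIntegral_of_isPrimitiveAt [FiniteDimensional ℝ E] (hα : 1 / 2 < α)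
    (hβ : IsSmoothOneForm β) {a b : ℝ} (hab : a ≤ b) (hy : IsHolderPath E α (Icc a b) y) {I : ℝ → F}
    (hI : ∀ r ∈ Icc a b, IsPrimitiveAt α β y I (Icc a b) r) :
    HasFormIntegral β y a b (I b - I a) := by
  have hcont : Continuous (fun s : Icc a b ↦ y s) := continuousOn_iff_continuous_domRestrict.1 hy.1
  obtain ⟨t, ht0, htm, ⟨n, hn⟩, hsub⟩ := exists_monotone_Icc_subset_open_cover_Icc hab
    (c := fun r : Icc a b ↦ (fun s : Icc a b ↦ y s) ⁻¹' (chartAt E (y r)).source)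
    (fun r ↦ (chartAt E (y r)).open_source.preimage hcont)
    (fun r _ ↦ mem_iUnion.2 ⟨r, mem_chart_source E (y r)⟩)
  choose i hi using hsub
  refine ⟨n, fun k ↦ t k, fun k ↦ chartAt E (y (i k)), fun k ↦ I (t (k + 1)) - I (t k), ht0,
    hn n le_rfl, ?_, fun k _ ↦ ?_⟩
  · rw [Finset.sum_range_sub (fun k ↦ I (t k)), ht0, hn n le_rfl]
  · have hs : Icc (t k : ℝ) (t (k + 1)) ⊆ Icc a b := Icc_subset_Icc (t k).2.1 (t (k + 1)).2.2
    have hsrc : ∀ s ∈ Icc (t k : ℝ) (t (k + 1)), y s ∈ (chartAt E (y (i k))).source :=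
      fun s hsk ↦ @hi k ⟨s, hs hsk⟩ ⟨hsk.1, hsk.2⟩
    exact ⟨htm k.le_succ, IsManifold.chart_mem_maximalAtlas _, hsrc,
      hasStieltjesIntegral_of_isPrimitiveAt hα hβ (IsManifold.chart_mem_maximalAtlas _)
        (hy.mono hs) hsrc fun r hr e he her ↦
          (hI r (hs hr) e he her).mono (nhdsWithin_mono r hs)⟩

/-- The integral of a form is the increment of any primitive; in particular it is unique. -/
theorem HasFormIntegral.eq_sub [FiniteDimensional ℝ E] (hα : 1 / 2 < α)
    (hβ : IsSmoothOneForm β) {a b : ℝ} (hy : IsHolderPath E α (Icc a b) y) {I : ℝ → F}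
    (hI : ∀ r ∈ Icc a b, IsPrimitiveAt α β y I (Icc a b) r) {v : F}
    (hv : HasFormIntegral β y a b v) : v = I b - I a := by
  obtain ⟨n, t, e, w, rfl, rfl, rfl, h⟩ := hv
  have hmono : ∀ i j, i ≤ j → j ≤ n → t i ≤ t j := by
    intro i j hij
    induction j, hij using Nat.le_induction with
    | base => exact fun _ ↦ le_rfl
    | succ j hij ih => exact fun hj ↦ (ih (by omega)).trans (h j hj).1
  rw [← Finset.sum_range_sub (fun k ↦ I (t k))]
  refine Finset.sum_congr rfl fun k hk ↦ ?_
  rw [Finset.mem_range] at hk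
  obtain ⟨h1, h2, h3, h4⟩ := h k hk
  have hs : Icc (t k) (t (k + 1)) ⊆ Icc (t 0) (t n) :=
    Icc_subset_Icc (hmono 0 k (Nat.zero_le _) hk.le) (hmono (k + 1) n hk le_rfl)
  exact h4.unique h1 (hasStieltjesIntegral_of_isPrimitiveAt hα hβ h2 (hy.mono hs) h3
    fun r hr e he her ↦ (hI r (hs hr) e he her).mono (nhdsWithin_mono r hs))

/-- All integrals of `β` along `y` over `[0, t]` vanish if and only if the zero function is a
primitive, that is if `β(y_s) (y_t - y_s)` is of order `2α` in charts. -/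
theorem forall_hasFormIntegral_zero_iff [FiniteDimensional ℝ E] [FiniteDimensional ℝ F]
    (hα : 1 / 2 < α) (hβ : IsSmoothOneForm β) (hJ : J.OrdConnected) (h0 : 0 ∈ J)
    (hJ0 : ∀ t ∈ J, 0 ≤ t) (hy : IsHolderPath E α J y) :
    (∀ t ∈ J, HasFormIntegral β y 0 t 0) ↔ ∀ r ∈ J, IsPrimitiveAt α β y 0 J r := by
  have hsub : ∀ b ∈ J, Icc 0 b ⊆ J := fun b hb ↦ hJ.out h0 hb
  constructor
  · intro h r hr
    have hb : ∃ b ∈ J, r ≤ b ∧ Icc 0 b ∈ 𝓝[J] r := by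
      by_cases hb : ∃ b ∈ J, r < b
      · obtain ⟨b, hb, hrb⟩ := hb
        refine ⟨b, hb, hrb.le, ?_⟩
        filter_upwards [self_mem_nhdsWithin, mem_nhdsWithin_of_mem_nhds (Iio_mem_nhds hrb)]
          with s hs hs' using ⟨hJ0 s hs, le_of_lt hs'⟩
      · push Not at hb
        refine ⟨r, hr, le_rfl, ?_⟩
        filter_upwards [self_mem_nhdsWithin] with s hs using ⟨hJ0 s hs, hb s hs⟩
    obtain ⟨b, hb, hrb, hmem⟩ := hb
    obtain ⟨I, hI⟩ := exists_isPrimitiveAt hα hβ (hJ0 b hb) (hy.mono (hsub b hb))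
    have hconst : ∀ t ∈ Icc 0 b, I t = I 0 := by
      intro t ht
      have hs : Icc 0 t ⊆ Icc 0 b := Icc_subset_Icc_right ht.2
      have := (h t (hsub b hb ht)).eq_sub hα hβ (hy.mono (hs.trans (hsub b hb)))
        fun r hr e he her ↦ (hI r (hs hr) e he her).mono (nhdsWithin_mono r hs)
      exact (sub_eq_zero.1 this.symm)
    intro e he her
    refine ((hI r ⟨hJ0 r hr, hrb⟩).mono_of_mem hmem e he her).congr hmem fun s t hs ht ↦ ?_
    rw [hconst s hs, hconst t ht]
    simp
  · intro h t ht
    have := hasFormIntegral_of_isPrimitiveAt hα hβ (hJ0 t ht) (hy.mono (hsub t ht))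
      fun r hr e he her ↦ (h r (hsub t ht hr) e he her).mono (nhdsWithin_mono r (hsub t ht))
    simpa using this

end Primitive

/-! ### The isomorphism given by a connection form -/

section Inverse

variable {E V F : Type*} [NormedAddCommGroup E] [NormedSpace ℝ E] [FiniteDimensional ℝ E]
  [NormedAddCommGroup V] [NormedSpace ℝ V] [FiniteDimensional ℝ V]
  [NormedAddCommGroup F] [NormedSpace ℝ F] [FiniteDimensional ℝ F]

/-- If the pair `(D z, a z)` is bijective at `z₀`, then near `z₀` its inverse splits into two smooth
families `h z`, `k z` of linear maps; `h z` lifts vectors of `V` to vectors of `E` killed by `a z`. -/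
theorem exists_smooth_splitting {D : E → E →L[ℝ] V} {a : E → E →L[ℝ] F} {z₀ : E}
    (hD : ContDiffAt ℝ ∞ D z₀) (ha : ContDiffAt ℝ ∞ a z₀)
    (hbij : Function.Bijective (fun v : E ↦ (D z₀ v, a z₀ v))) :
    ∃ (h : E → V →L[ℝ] E) (k : E → F →L[ℝ] E), ContDiffAt ℝ ∞ h z₀ ∧ ContDiffAt ℝ ∞ k z₀ ∧
      ∀ᶠ z in 𝓝 z₀, (∀ x, D z (h z x) = x) ∧ (∀ x, a z (h z x) = 0) ∧
        ∀ v, h z (D z v) + k z (a z v) = v := by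
  have : CompleteSpace E := FiniteDimensional.complete ℝ E
  have : CompleteSpace V := FiniteDimensional.complete ℝ V
  have : CompleteSpace F := FiniteDimensional.complete ℝ F
  let Φ : E → E →L[ℝ] V × F := fun z ↦ (D z).prod (a z)
  have hΦ : ContDiffAt ℝ ∞ Φ z₀ := by
    have h2 : ContDiffAt ℝ ∞ (fun z ↦ (ContinuousLinearMap.inl ℝ V F).comp (D z)
        + (ContinuousLinearMap.inr ℝ V F).comp (a z)) z₀ :=
      (contDiffAt_const.clm_comp hD).add (contDiffAt_const.clm_comp ha)
    refine h2.congr_of_eventuallyEq (Eventually.of_forall fun z ↦ ?_)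
    ext v <;> simp [Φ]
  let Λ : E ≃L[ℝ] V × F := ContinuousLinearEquiv.ofBijective (Φ z₀)
    (LinearMap.ker_eq_bot.2 hbij.1) (LinearMap.range_eq_top.2 hbij.2)
  have hΛ : (Λ : E →L[ℝ] V × F) = Φ z₀ := ContinuousLinearEquiv.coe_ofBijective _ _ _
  have hinv : ContDiffAt ℝ ∞ (fun z ↦ (Φ z).inverse) z₀ := by
    have h1 : ContDiffAt ℝ ∞ (ContinuousLinearMap.inverse (R := ℝ)) (Φ z₀) :=
      hΛ ▸ contDiffAt_map_inverse Λ
    exact h1.comp z₀ hΦ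
  refine ⟨fun z ↦ (Φ z).inverse.comp (ContinuousLinearMap.inl ℝ V F),
    fun z ↦ (Φ z).inverse.comp (ContinuousLinearMap.inr ℝ V F), hinv.clm_comp contDiffAt_const,
    hinv.clm_comp contDiffAt_const, ?_⟩
  have hev : ∀ᶠ z in 𝓝 z₀, Φ z ∈ range ((↑) : (E ≃L[ℝ] V × F) → E →L[ℝ] V × F) :=
    hΦ.continuousAt.eventually (hΛ ▸ ContinuousLinearEquiv.nhds Λ)
  filter_upwards [hev] with z hz
  obtain ⟨Λz, hΛz⟩ := hz
  have hi : (Φ z).inverse = (Λz.symm : V × F →L[ℝ] E) := by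
    rw [← hΛz, ContinuousLinearMap.inverse_equiv]
  have happ : ∀ v, Λz v = (D z v, a z v) := fun v ↦ by
    change (Λz : E →L[ℝ] V × F) v = _
    rw [hΛz]
    rfl
  have hback : ∀ x y, (D z (Λz.symm (x, y)), a z (Λz.symm (x, y))) = (x, y) := fun x y ↦ by
    rw [← happ, Λz.apply_symm_apply]
  refine ⟨fun x ↦ ?_, fun x ↦ ?_, fun v ↦ ?_⟩
  · simpa [hi] using congrArg Prod.fst (hback x 0)
  · simpa [hi] using congrArg Prod.snd (hback x 0)
  · simp only [hi, ContinuousLinearMap.comp_apply, ContinuousLinearMap.inl_apply,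
      ContinuousLinearMap.inr_apply]
    change Λz.symm (D z v, 0) + Λz.symm (0, a z v) = v
    rw [← map_add, Prod.mk_add_mk, add_zero, zero_add, ← happ, Λz.symm_apply_apply]

end Inverse

section ChainRule

variable {E E' E'' H H' H'' N N' N'' : Type*} [NormedAddCommGroup E] [NormedSpace ℝ E]
  [NormedAddCommGroup E'] [NormedSpace ℝ E'] [NormedAddCommGroup E''] [NormedSpace ℝ E'']
  [TopologicalSpace H] [TopologicalSpace H'] [TopologicalSpace H'']
  {I : ModelWithCorners ℝ E H} {I' : ModelWithCorners ℝ E' H'} {I'' : ModelWithCorners ℝ E'' H''}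
  [TopologicalSpace N] [ChartedSpace H N] [TopologicalSpace N'] [ChartedSpace H' N']
  [TopologicalSpace N''] [ChartedSpace H'' N'']

/-- The chain rule with tangent vectors regarded as vectors of the model spaces, so that the base
point `f x` may be replaced by a propositionally equal one. -/
theorem mfderiv_comp_model {f : N → N'} {g : N' → N''} {x : N} {y : N'}
    (hg : MDifferentiableAt I' I'' g y) (hf : MDifferentiableAt I I' f x) (hy : f x = y) (v : E) :
    (mfderiv I I'' (g ∘ f) x : E →L[ℝ] E'') v
      = (mfderiv I' I'' g y : E' →L[ℝ] E'') ((mfderiv I I' f x : E →L[ℝ] E') v) := by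
  subst hy
  exact congrArg (fun L : E →L[ℝ] E'' ↦ L v) (mfderiv_comp x hg hf)

end ChainRule

section Bundle

variable {EM : Type*} [NormedAddCommGroup EM] [NormedSpace ℝ EM]
  {M : Type*} [TopologicalSpace M] [ChartedSpace EM M]
  {EG : Type*} [NormedAddCommGroup EG] [NormedSpace ℝ EG]
  {G : Type*} [TopologicalSpace G] [ChartedSpace EG G] [Group G]
  {EP : Type*} [NormedAddCommGroup EP] [NormedSpace ℝ EP]
  {P : Type*} [TopologicalSpace P] [ChartedSpace EP P]
  [MulAction Gᵐᵒᵖ P] {π : P → M}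

theorem IsPrincipalBundle.proj_act (hπ : IsPrincipalBundle EM EG EP G π) (p : P) (g : G) :
    π (p <• g) = π p :=
  ((hπ.fibre p _).2 ⟨g, rfl⟩).symm

theorem IsPrincipalBundle.mdifferentiableAt_orbit (hπ : IsPrincipalBundle EM EG EP G π) (p : P)
    (g : G) : MDifferentiableAt 𝓘(ℝ, EG) 𝓘(ℝ, EP) (fun g : G ↦ p <• g) g := by
  have h : ContMDiff 𝓘(ℝ, EG) 𝓘(ℝ, EP) ∞ (fun g : G ↦ p <• g) :=
    hπ.contMDiff_act.comp (contMDiff_const.prodMk contMDiff_id)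
  exact h.mdifferentiable (by simp) g

theorem IsPrincipalBundle.mfderiv_fundamentalField (hπ : IsPrincipalBundle EM EG EP G π)
    (A : GroupLieAlgebra 𝓘(ℝ, EG) G) (p : P) :
    (mfderiv 𝓘(ℝ, EP) 𝓘(ℝ, EM) π p (fundamentalField A p) : EM) = 0 := by
  have h1 : MDifferentiableAt 𝓘(ℝ, EP) 𝓘(ℝ, EM) π p :=
    hπ.contMDiff_proj.mdifferentiable (by simp) p
  have h2 := hπ.mdifferentiableAt_orbit p (1 : G)
  have h3 : π ∘ (fun g : G ↦ p <• g) = fun _ ↦ π p := funext fun g ↦ hπ.proj_act p g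
  have h4 := mfderiv_comp_model h1 h2 (by simp) A
  rw [h3, mfderiv_const] at h4
  exact h4.symm

variable [LieGroup 𝓘(ℝ, EG) ∞ G]

/-- The projection of a principal bundle is a submersion whose vertical vectors are the fundamental
ones. In a local trivialization, points `q` near `p` are `τ (π q) <• k q` with `τ` a local section
through `p` and `k p = 1`; differentiating this identity at `p` in a vertical direction leaves only
the derivative of the orbit map. -/
theorem IsPrincipalBundle.surjective_mfderiv_and_vertical (hπ : IsPrincipalBundle EM EG EP G π)
    (p : P) :
    Function.Surjective (fun v : EP ↦ (mfderiv 𝓘(ℝ, EP) 𝓘(ℝ, EM) π p v : EM)) ∧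
    ∀ v : EP, (mfderiv 𝓘(ℝ, EP) 𝓘(ℝ, EM) π p v : EM) = 0 →
      ∃ A : GroupLieAlgebra 𝓘(ℝ, EG) G, v = (fundamentalField A p : EP) := by
  obtain ⟨U, φ, hU, hpU, hsrc, htgt, hφ, hφs, heq⟩ := hπ.locallyTrivial (π p)
  have hp : p ∈ φ.source := by rw [hsrc]; exact hpU
  set g₀ : G := (φ p).2 with hg₀
  let τ : M → P := fun m ↦ φ.symm (m, g₀)
  have htm : ∀ m ∈ U, (m, g₀) ∈ φ.target := fun m hm ↦ by rw [htgt]; exact ⟨hm, mem_univ _⟩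
  have hτsrc : ∀ m ∈ U, τ m ∈ φ.source := fun m hm ↦ φ.map_target (htm m hm)
  have hφτ : ∀ m ∈ U, φ (τ m) = (m, g₀) := fun m hm ↦ φ.right_inv (htm m hm)
  have hπτ : ∀ m ∈ U, π (τ m) = m := fun m hm ↦ by
    rw [← (heq _ (hτsrc m hm)).1, hφτ m hm]
  have hφp : φ p = (π p, g₀) := Prod.ext (heq p hp).1 rfl
  have hτp : τ (π p) = p := by
    simp only [τ]
    rw [← hφp, φ.left_inv hp]
  have dπ : MDifferentiableAt 𝓘(ℝ, EP) 𝓘(ℝ, EM) π p :=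
    hπ.contMDiff_proj.mdifferentiable (by simp) p
  have dτ : MDifferentiableAt 𝓘(ℝ, EM) 𝓘(ℝ, EP) τ (π p) := by
    have h1 : ContMDiffAt (𝓘(ℝ, EM).prod 𝓘(ℝ, EG)) 𝓘(ℝ, EP) ∞ φ.symm (π p, g₀) :=
      hφs.contMDiffAt (φ.open_target.mem_nhds (htm _ hpU))
    have h2 : ContMDiffAt 𝓘(ℝ, EM) (𝓘(ℝ, EM).prod 𝓘(ℝ, EG)) ∞ (fun m : M ↦ (m, g₀)) (π p) :=
      contMDiffAt_id.prodMk contMDiffAt_const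
    exact (h1.comp (π p) h2).mdifferentiableAt (by simp)
  let k : P → G := fun q ↦ g₀⁻¹ * (φ q).2
  have hkp : k p = 1 := inv_mul_cancel g₀
  have dk : MDifferentiableAt 𝓘(ℝ, EP) 𝓘(ℝ, EG) k p := by
    have h1 : ContMDiffAt 𝓘(ℝ, EP) 𝓘(ℝ, EG) ∞ (fun q ↦ (φ q).2) p :=
      (hφ.contMDiffAt (φ.open_source.mem_nhds hp)).snd
    exact (contMDiffAt_const.mul h1).mdifferentiableAt (by simp)
  constructor
  · intro w
    have h1 : π ∘ τ =ᶠ[𝓝 (π p)] id := by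
      filter_upwards [hU.mem_nhds hpU] with m hm using hπτ m hm
    have h2 := mfderiv_comp_model dπ dτ hτp w
    rw [h1.mfderiv_eq, mfderiv_id] at h2
    exact ⟨(mfderiv 𝓘(ℝ, EM) 𝓘(ℝ, EP) τ (π p) w : EP), h2.symm⟩
  · intro v hv
    let act : P × G → P := fun q ↦ q.1 <• q.2
    have dact : MDifferentiableAt (𝓘(ℝ, EP).prod 𝓘(ℝ, EG)) 𝓘(ℝ, EP) act (p, 1) :=
      hπ.contMDiff_act.mdifferentiable (by simp) _
    have dpair : MDifferentiableAt 𝓘(ℝ, EP) (𝓘(ℝ, EP).prod 𝓘(ℝ, EG))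
        (fun q ↦ (τ (π q), k q)) p := (dτ.comp p dπ).prodMk dk
    have hid : act ∘ (fun q ↦ (τ (π q), k q)) =ᶠ[𝓝 p] id := by
      filter_upwards [φ.open_source.mem_nhds hp] with q hq
      have hqU : π q ∈ U := by rwa [hsrc] at hq
      have hs : τ (π q) <• k q ∈ φ.source := by
        rw [hsrc, mem_preimage, hπ.proj_act, hπτ _ hqU]
        exact hqU
      refine φ.injOn hs hq (Prod.ext ?_ ?_)
      · rw [(heq _ hs).1, hπ.proj_act, hπτ _ hqU, id, (heq _ hq).1]
      · rw [(heq _ (hτsrc _ hqU)).2, hφτ _ hqU]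
        exact mul_inv_cancel_left _ _
    have h1 := mfderiv_comp_model dact dpair (Prod.ext hτp hkp) v
    rw [hid.mfderiv_eq, mfderiv_id] at h1
    have h2 : (mfderiv 𝓘(ℝ, EP) (𝓘(ℝ, EP).prod 𝓘(ℝ, EG)) (fun q ↦ (τ (π q), k q)) p v : EP × EG)
        = (0, (mfderiv 𝓘(ℝ, EP) 𝓘(ℝ, EG) k p v : EG)) := by
      have h3 := MDifferentiableAt.mfderiv_prod (dτ.comp p dπ) dk
      have h4 := mfderiv_comp p dτ dπ
      refine (congrArg (fun L : EP →L[ℝ] EP × EG ↦ L v) h3).trans (Prod.ext ?_ rfl)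
      refine (congrArg (fun L : EP →L[ℝ] EP ↦ L v) h4).trans ?_
      change (mfderiv 𝓘(ℝ, EM) 𝓘(ℝ, EP) τ (π p) : EM →L[ℝ] EP)
        (mfderiv 𝓘(ℝ, EP) 𝓘(ℝ, EM) π p v : EM) = 0
      rw [hv, map_zero]
    refine ⟨(mfderiv 𝓘(ℝ, EP) 𝓘(ℝ, EG) k p v : EG), ?_⟩
    have h5 : v = (mfderiv (𝓘(ℝ, EP).prod 𝓘(ℝ, EG)) 𝓘(ℝ, EP) act (p, 1) :
        EP × EG →L[ℝ] EP) (mfderiv 𝓘(ℝ, EP) (𝓘(ℝ, EP).prod 𝓘(ℝ, EG))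
          (fun q ↦ (τ (π q), k q)) p v : EP × EG) := h1
    rw [h2] at h5
    refine h5.trans ((mfderiv_prod_eq_add_apply dact).trans ?_)
    change (mfderiv 𝓘(ℝ, EP) 𝓘(ℝ, EP) (fun z ↦ act (z, 1)) p : EP →L[ℝ] EP) 0 + _ = _
    rw [map_zero, zero_add]
    rfl

variable [IsManifold 𝓘(ℝ, EP) ∞ P]

/-- A connection form completes the differential of the projection to an isomorphism
`T_p P ≃ T_{π p} M × 𝔤`. -/
theorem IsConnectionForm.bijective (hπ : IsPrincipalBundle EM EG EP G π)
    {η : ∀ p : P, TangentSpace 𝓘(ℝ, EP) p →L[ℝ] GroupLieAlgebra 𝓘(ℝ, EG) G}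
    (hη : IsConnectionForm η) (p : P) : Function.Bijective
      (fun v : EP ↦ ((mfderiv 𝓘(ℝ, EP) 𝓘(ℝ, EM) π p v : EM), (η p v : EG))) := by
  obtain ⟨hsurj, hvert⟩ := hπ.surjective_mfderiv_and_vertical p
  let D : EP →L[ℝ] EM := mfderiv 𝓘(ℝ, EP) 𝓘(ℝ, EM) π p
  let a : EP →L[ℝ] EG := η p
  have hV : ∀ A : EG, D (fundamentalField (G := G) A p : EP) = 0 := fun A ↦
    hπ.mfderiv_fundamentalField A p
  have ha : ∀ A : EG, a (fundamentalField (G := G) A p : EP) = A := fun A ↦ hη.vertical A p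
  constructor
  · intro v w hvw
    have h1 : D v = D w := congrArg Prod.fst hvw
    have h2 : a v = a w := congrArg Prod.snd hvw
    obtain ⟨A, hA⟩ := hvert (v - w) (show D (v - w) = 0 by rw [map_sub, h1, sub_self])
    have h3 : a (v - w) = A := by
      rw [hA]
      exact ha A
    rw [map_sub, h2, sub_self] at h3
    have h4 : (fundamentalField (G := G) A p : EP) = 0 := by
      rw [← h3]
      exact map_zero (mfderiv 𝓘(ℝ, EG) 𝓘(ℝ, EP) (fun g : G ↦ p <• g) 1 : EG →L[ℝ] EP)
    rw [h4] at hA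
    exact sub_eq_zero.1 hA
  · have h : ∀ (m : EM) (A : EG), ∃ v : EP, D v = m ∧ a v = A := by
      intro m A
      obtain ⟨v, hv⟩ := hsurj m
      let w : EP := fundamentalField (G := G) (A - a v : EG) p
      have hw : a w = A - a v := ha (A - a v)
      have hw' : D w = 0 := hV (A - a v)
      refine ⟨(v : EP) + w, ?_, ?_⟩
      · rw [map_add, hw', add_zero]
        exact hv
      · rw [map_add, hw, add_sub_cancel]
    rintro ⟨m, A⟩
    obtain ⟨v, h1, h2⟩ := h m A
    exact ⟨v, Prod.ext h1 h2⟩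

variable [IsManifold 𝓘(ℝ, EM) ∞ M]

/-- The isomorphism `(dπ, η)` in charts. -/
theorem IsConnectionForm.bijective_chart (hπ : IsPrincipalBundle EM EG EP G π)
    {η : ∀ p : P, TangentSpace 𝓘(ℝ, EP) p →L[ℝ] GroupLieAlgebra 𝓘(ℝ, EG) G}
    (hη : IsConnectionForm η) (p : P) (m : M) {z : EP} (hz : z ∈ (chartAt EP p).target)
    (hm : π ((chartAt EP p).symm z) ∈ (chartAt EM m).source) : Function.Bijective
      (fun v : EP ↦ (fderiv ℝ (fun w ↦ chartAt EM m (π ((chartAt EP p).symm w))) z v,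
        formInChart (F := EG) (chartAt EP p) η z v)) := by
  have de : Function.Bijective
      (mfderiv 𝓘(ℝ, EP) 𝓘(ℝ, EP) (chartAt EP p).symm z : EP →L[ℝ] EP) :=
    (mdifferentiable_chart (I := 𝓘(ℝ, EP)) p).symm.mfderiv_bijective hz
  have dc : Function.Bijective
      (mfderiv 𝓘(ℝ, EM) 𝓘(ℝ, EM) (chartAt EM m) (π ((chartAt EP p).symm z)) : EM →L[ℝ] EM) :=
    (mdifferentiable_chart (I := 𝓘(ℝ, EM)) m).mfderiv_bijective hm
  have hb := (hη.bijective hπ ((chartAt EP p).symm z)).comp de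
  have hb' := dc.prodMap (Function.bijective_id (α := EG))
  have d1 := (mdifferentiable_chart (I := 𝓘(ℝ, EP)) p).symm.mdifferentiableAt hz
  have d2 : MDifferentiableAt 𝓘(ℝ, EP) 𝓘(ℝ, EM) π ((chartAt EP p).symm z) :=
    hπ.contMDiff_proj.mdifferentiable (by simp) _
  have d3 := (mdifferentiable_chart (I := 𝓘(ℝ, EM)) m).mdifferentiableAt hm
  have hfun : (fun v : EP ↦ (fderiv ℝ (fun w ↦ chartAt EM m (π ((chartAt EP p).symm w))) z v,
      formInChart (F := EG) (chartAt EP p) η z v)) = Prod.map (mfderiv 𝓘(ℝ, EM) 𝓘(ℝ, EM) (chartAt EM m)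
        (π ((chartAt EP p).symm z)) : EM →L[ℝ] EM) id ∘ (fun v : EP ↦
        ((mfderiv 𝓘(ℝ, EP) 𝓘(ℝ, EM) π ((chartAt EP p).symm z) v : EM),
          (η ((chartAt EP p).symm z) v : EG))) ∘
        (mfderiv 𝓘(ℝ, EP) 𝓘(ℝ, EP) (chartAt EP p).symm z : EP →L[ℝ] EP) := by
    funext v
    refine Prod.ext ?_ rfl
    have h1 := mfderiv_comp_model d3 (d2.comp z d1) rfl v
    have h2 := mfderiv_comp_model d2 d1 rfl v
    rw [h2, mfderiv_eq_fderiv] at h1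
    exact h1
  rw [hfun]
  exact hb'.comp hb

end Bundle

/-! ### Local existence and uniqueness of lifts -/

section Lift

variable {M : Type*} {EG : Type*} [NormedAddCommGroup EG] [NormedSpace ℝ EG]
  {G : Type*} [TopologicalSpace G] [ChartedSpace EG G] [Group G]
  {EP : Type*} [NormedAddCommGroup EP] [NormedSpace ℝ EP]
  {P : Type*} [TopologicalSpace P] [ChartedSpace EP P] {π : P → M}
  {η : ∀ p : P, TangentSpace 𝓘(ℝ, EP) p →L[ℝ] GroupLieAlgebra 𝓘(ℝ, EG) G}
  {α : ℝ} {x : ℝ → M} {J J' : Set ℝ} {y y' : ℝ → P} {r : ℝ}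

/-- The local form of a horizontal lift: the condition on the integrals of `η` is replaced by the
condition that `η(y_s) (y_t - y_s)` is of order `2α` in charts. -/
structure IsYoungLift (π : P → M)
    (η : ∀ p : P, TangentSpace 𝓘(ℝ, EP) p →L[ℝ] GroupLieAlgebra 𝓘(ℝ, EG) G)
    (α : ℝ) (x : ℝ → M) (J : Set ℝ) (y : ℝ → P) : Prop where
  holder : IsHolderPath EP α J y
  proj : ∀ t ∈ J, π (y t) = x t
  primitive : ∀ r ∈ J, IsPrimitiveAt (F := EG) α η y 0 J r

theorem IsYoungLift.mono (h : IsYoungLift π η α x J y) (hJ : J' ⊆ J) : IsYoungLift π η α x J' y :=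
  ⟨h.holder.mono hJ, fun t ht ↦ h.proj t (hJ ht), fun r hr e he her ↦
    (h.primitive r (hJ hr) e he her).mono (nhdsWithin_mono r hJ)⟩

/-- To be a lift is a local property in time. -/
theorem IsYoungLift.of_local (h : ∀ r ∈ J, ∃ (J' : Set ℝ) (y' : ℝ → P), IsYoungLift π η α x J' y' ∧
    r ∈ J' ∧ J' ∈ 𝓝[J] r ∧ ∀ᶠ t in 𝓝[J] r, y' t = y t) : IsYoungLift π η α x J y := by
  refine ⟨isHolderPath_iff.2 ⟨fun r hr ↦ ?_, fun r hr ↦ ?_⟩, fun r hr ↦ ?_, fun r hr ↦ ?_⟩ <;>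
    obtain ⟨J', y', hy', hrJ', hJ', heq⟩ := h r hr <;>
    have heqr : y' r = y r := heq.self_of_nhdsWithin hr
  · have h1 : ContinuousWithinAt y' J r := (hy'.holder.1 r hrJ').mono_of_mem_nhdsWithin hJ'
    exact h1.congr_of_eventuallyEq (heq.mono fun _ h ↦ h.symm) heqr.symm
  · refine (((isHolderPath_iff.1 hy'.holder).2 r hrJ').mono (nhdsWithin_le_of_mem hJ')).congr heq
      fun s t hs ht ↦ ?_
    rw [hs, ht, heqr]
  · rw [← heqr]
    exact hy'.proj r hrJ'
  · intro e he her
    refine ((hy'.primitive r hrJ').mono_of_mem hJ' e he (by rwa [heqr])).congr heq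
      fun s t hs ht ↦ ?_
    rw [hs, ht]

/-- The times up to which a lift starting at `u` exists. -/
def liftTimes (π : P → M)
    (η : ∀ p : P, TangentSpace 𝓘(ℝ, EP) p →L[ℝ] GroupLieAlgebra 𝓘(ℝ, EG) G)
    (α : ℝ) (x : ℝ → M) (T : ℝ) (u : P) : Set ℝ :=
  {b | b ∈ Icc 0 T ∧ ∃ y : ℝ → P, IsYoungLift π η α x (Icc 0 b) y ∧ y 0 = u}

theorem ordConnected_liftTimes {T : ℝ} {u : P} : (liftTimes π η α x T u).OrdConnected := by
  refine ⟨fun a ha b hb t ht ↦ ?_⟩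
  obtain ⟨hbT, y, hy, hy0⟩ := hb
  exact ⟨⟨ha.1.1.trans ht.1, ht.2.trans hbT.2⟩, y, hy.mono (Icc_subset_Icc_right ht.2), hy0⟩

variable [IsManifold 𝓘(ℝ, EP) ∞ P]

theorem isHorizontalLift_iff [FiniteDimensional ℝ EG] [FiniteDimensional ℝ EP] [MulAction Gᵐᵒᵖ P]
    (hα : 1 / 2 < α) (hη : IsConnectionForm η) (hJ : J.OrdConnected) (h0 : 0 ∈ J) (hJ0 : ∀ t ∈ J, 0 ≤ t) {u : P} :
    IsHorizontalLift π η α x u J y ↔ IsYoungLift π η α x J y ∧ y 0 = u :=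
  ⟨fun h ↦ ⟨⟨h.holder, h.proj, (forall_hasFormIntegral_zero_iff (F := EG) hα hη.smooth hJ h0 hJ0
    h.holder).1 h.horizontal⟩, h.init⟩, fun h ↦ ⟨h.1.holder, h.2, h.1.proj,
    (forall_hasFormIntegral_zero_iff (F := EG) hα hη.smooth hJ h0 hJ0 h.1.holder).2 h.1.primitive⟩⟩

variable {EM : Type*} [NormedAddCommGroup EM] [NormedSpace ℝ EM] [TopologicalSpace M]
  [ChartedSpace EM M]

/-- The projection `π` in the preferred charts at `p` and `π p`. -/
noncomputable def projInChart (π : P → M) (p : P) (z : EP) : EM :=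
  chartAt EM (π p) (π ((chartAt EP p).symm z))

/-- At the point `z` of the chart at `p`, the map `h z` is the horizontal lift of tangent vectors
of `M` and `k z` is the inclusion of the Lie algebra as vertical vectors, so that they invert the
isomorphism `(dπ, η)`. -/
structure IsHorizontalFrame (π : P → M)
    (η : ∀ p : P, TangentSpace 𝓘(ℝ, EP) p →L[ℝ] GroupLieAlgebra 𝓘(ℝ, EG) G) (p : P)
    (h : EP → EM →L[ℝ] EP) (k : EP → EG →L[ℝ] EP) (z : EP) : Prop where
  mem_target : z ∈ (chartAt EP p).target
  mem_source : π ((chartAt EP p).symm z) ∈ (chartAt EM (π p)).source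
  contDiffAt_proj : ContDiffAt ℝ ∞ (projInChart (EM := EM) (EP := EP) π p) z
  proj_lift : ∀ v, fderiv ℝ (projInChart π p) z (h z v) = v
  form_lift : ∀ v, formInChart (F := EG) (chartAt EP p) η z (h z v) = 0
  decomp : ∀ w, h z (fderiv ℝ (projInChart π p) z w)
    + k z (formInChart (F := EG) (chartAt EP p) η z w) = w

/-- In charts, a lift solves the Young equation `dY = h(Y) dX`, where `h` is the horizontal lift of
tangent vectors. -/
theorem IsYoungLift.nearO_equation (hy : IsYoungLift π η α x J y)
    (hr : r ∈ J) {h : EP → EM →L[ℝ] EP} {k : EP → EG →L[ℝ] EP}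
    (hh : ContDiffAt ℝ ∞ h (chartAt EP (y r) (y r)))
    (hk : ContDiffAt ℝ ∞ k (chartAt EP (y r) (y r)))
    (hfr : ∀ᶠ z in 𝓝 (chartAt EP (y r) (y r)), IsHorizontalFrame π η (y r) h k z) :
    NearO (2 * α) (𝓝[J] r) (fun s t ↦ chartAt EP (y r) (y t) - chartAt EP (y r) (y s)
      - h (chartAt EP (y r) (y s))
        (chartAt EM (π (y r)) (x t) - chartAt EM (π (y r)) (x s))) := by
  set e := chartAt EP (y r) with he
  have hsrc := mem_chart_source EP (y r)
  have hatl := IsManifold.chart_mem_maximalAtlas (I := 𝓘(ℝ, EP)) (n := ∞) (y r)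
  have hc := hy.holder.1 r hr
  have hY := hy.holder.nearO hatl hr hsrc
  have hlim := tendsto_chart hc hsrc
  have h1 := nearO_taylor hY hlim (hfr.self_of_nhds.contDiffAt_proj.of_le two_le_infty)
  have h2 := h1.clm_apply (A := fun s ↦ h (e (y s)))
    (((hh.continuousAt.tendsto.comp hlim).norm.eventually_lt_const (lt_add_one _)).mono
      fun _ h ↦ h.le)
  have h3 := (hy.primitive r hr e hatl hsrc).clm_apply (A := fun s ↦ k (e (y s)))
    (((hk.continuousAt.tendsto.comp hlim).norm.eventually_lt_const (lt_add_one _)).mono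
      fun _ h ↦ h.le)
  have hp : ∀ᶠ s in 𝓝[J] r, s ∈ J ∧ y s ∈ e.source ∧ IsHorizontalFrame π η (y r) h k (e (y s)) :=
    Eventually.and self_mem_nhdsWithin ((eventually_mem_source hc hsrc).and (hlim.eventually hfr))
  have hX : ∀ s, s ∈ J → y s ∈ e.source →
      projInChart π (y r) (e (y s)) = chartAt EM (π (y r)) (x s) := fun s hs hse ↦ by
    simp only [projInChart, ← he]
    rw [e.left_inv hse, hy.proj s hs]
  have hneg : NearO (2 * α) (𝓝[J] r) (fun _ _ ↦ (0 : EP)) := Asymptotics.isBigO_zero _ _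
  refine ((hneg.sub h2).sub h3).congr hp fun s t hs ht ↦ ?_
  have h4 := hs.2.2.decomp (e (y t) - e (y s))
  rw [hX s hs.1 hs.2.1, hX t ht.1 ht.2.1]
  simp only [Pi.zero_apply, sub_zero, zero_sub, map_neg, sub_neg_eq_add]
  rw [map_sub (h (e (y s))) (_ - _)]
  rw [← he] at h4
  calc _ = h (e (y s)) (fderiv ℝ (projInChart π (y r)) (e (y s)) (e (y t) - e (y s)))
        + k (e (y s)) (formInChart (F := EG) e η (e (y s)) (e (y t) - e (y s)))
        - h (e (y s)) (chartAt EM (π (y r)) (x t) - chartAt EM (π (y r)) (x s)) := by abel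
    _ = _ := by rw [h4]

variable [MulAction Gᵐᵒᵖ P] [FiniteDimensional ℝ EM] [FiniteDimensional ℝ EG]
  [FiniteDimensional ℝ EP] [LieGroup 𝓘(ℝ, EG) ∞ G] [IsManifold 𝓘(ℝ, EM) ∞ M]

theorem exists_horizontalFrame (hπ : IsPrincipalBundle EM EG EP G π) (hη : IsConnectionForm η)
    (p : P) : ∃ (h : EP → EM →L[ℝ] EP) (k : EP → EG →L[ℝ] EP),
      ContDiffAt ℝ ∞ h (chartAt EP p p) ∧ ContDiffAt ℝ ∞ k (chartAt EP p p) ∧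
      ∀ᶠ z in 𝓝 (chartAt EP p p), IsHorizontalFrame π η p h k z := by
  have hp := mem_chart_source EP p
  have htgt : ∀ᶠ z in 𝓝 (chartAt EP p p), z ∈ (chartAt EP p).target :=
    (chartAt EP p).open_target.mem_nhds ((chartAt EP p).map_source hp)
  have hcont : ∀ᶠ z in 𝓝 (chartAt EP p p),
      π ((chartAt EP p).symm z) ∈ (chartAt EM (π p)).source := by
    have h1 : ContinuousAt (fun z ↦ π ((chartAt EP p).symm z)) (chartAt EP p p) :=
      hπ.contMDiff_proj.continuous.continuousAt.comp
        ((chartAt EP p).continuousAt_symm ((chartAt EP p).map_source hp))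
    refine h1.eventually ((chartAt EM (π p)).open_source.mem_nhds ?_)
    simp only [(chartAt EP p).left_inv hp]
    exact mem_chart_source EM (π p)
  have hsm : ∀ᶠ z in 𝓝 (chartAt EP p p),
      ContDiffAt ℝ ∞ (projInChart (EM := EM) (EP := EP) π p) z := by
    filter_upwards [htgt, hcont] with z hz hz'
    have h1 : ContMDiffAt 𝓘(ℝ, EP) 𝓘(ℝ, EP) ∞ (chartAt EP p).symm z :=
      contMDiffAt_symm_of_mem_maximalAtlas (IsManifold.chart_mem_maximalAtlas p) hz
    have h2 : ContMDiffAt 𝓘(ℝ, EM) 𝓘(ℝ, EM) ∞ (chartAt EM (π p)) (π ((chartAt EP p).symm z)) :=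
      contMDiffAt_of_mem_maximalAtlas (IsManifold.chart_mem_maximalAtlas _) hz'
    exact contMDiffAt_iff_contDiffAt.1 (h2.comp z (hπ.contMDiff_proj.contMDiffAt.comp z h1))
  have hD : ContDiffAt ℝ ∞ (fderiv ℝ (projInChart (EM := EM) (EP := EP) π p)) (chartAt EP p p) :=
    hsm.self_of_nhds.fderiv_right (by simp)
  obtain ⟨h, k, hh, hk, hev⟩ := exists_smooth_splitting hD
    (contDiffAt_formInChart (F := EG) hη.smooth (IsManifold.chart_mem_maximalAtlas p)
      htgt.self_of_nhds)
    (hη.bijective_chart hπ p (π p) htgt.self_of_nhds hcont.self_of_nhds)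
  refine ⟨h, k, hh, hk, ?_⟩
  filter_upwards [htgt, hcont, hsm, hev] with z h1 h2 h3 h4
  exact ⟨h1, h2, h3, h4.1, h4.2.1, h4.2.2⟩

/-- Two lifts that meet at a time agree around it. -/
theorem IsYoungLift.eventually_eq (hα : 1 / 2 < α) (hπ : IsPrincipalBundle EM EG EP G π)
    (hη : IsConnectionForm η) (hJ : J.OrdConnected) (hx : IsHolderPath EM α J x)
    (hy : IsYoungLift π η α x J y) (hy' : IsYoungLift π η α x J y') (hr : r ∈ J)
    (h0 : y r = y' r) : ∀ᶠ t in 𝓝[J] r, y t = y' t := by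
  obtain ⟨h, k, hh, hk, hfr⟩ := exists_horizontalFrame hπ hη (y r)
  have hatl := IsManifold.chart_mem_maximalAtlas (I := 𝓘(ℝ, EP)) (n := ∞) (y r)
  have hatlM := IsManifold.chart_mem_maximalAtlas (I := 𝓘(ℝ, EM)) (n := ∞) (π (y r))
  have hsrc := mem_chart_source EP (y r)
  have hsrc' : y' r ∈ (chartAt EP (y r)).source := h0 ▸ hsrc
  have hxs : x r ∈ (chartAt EM (π (y r))).source := by
    rw [← hy.proj r hr]
    exact mem_chart_source EM _
  have e1 := hy.nearO_equation hr hh hk hfr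
  have e2 : NearO (2 * α) (𝓝[J] r) (fun s t ↦ chartAt EP (y r) (y' t) - chartAt EP (y r) (y' s)
      - h (chartAt EP (y r) (y' s))
        (chartAt EM (π (y r)) (x t) - chartAt EM (π (y r)) (x s))) := by
    rw [h0] at hh hk hfr ⊢
    exact hy'.nearO_equation hr hh hk hfr
  have l1 := tendsto_chart (hy.holder.1 r hr) hsrc
  have l2 := tendsto_chart (hy'.holder.1 r hr) hsrc'
  rw [← h0] at l2
  have := young_solution_eventually_eq hα (hh.of_le two_le_infty) hJ hr
    (hx.nearO hatlM hr hxs) (hy.holder.nearO hatl hr hsrc) (hy'.holder.nearO hatl hr hsrc')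
    l1 l2 e1 e2 (by rw [h0])
  filter_upwards [this, eventually_mem_source (hy.holder.1 r hr) hsrc,
    eventually_mem_source (hy'.holder.1 r hr) hsrc'] with t ht hs hs'
  exact (chartAt EP (y r)).injOn hs hs' ht

/-- Two lifts on an interval that meet once are equal. -/
theorem IsYoungLift.eqOn [T2Space P] (hα : 1 / 2 < α) (hπ : IsPrincipalBundle EM EG EP G π)
    (hη : IsConnectionForm η) (hJ : J.OrdConnected) (hx : IsHolderPath EM α J x)
    (hy : IsYoungLift π η α x J y) (hy' : IsYoungLift π η α x J y') (hr : r ∈ J)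
    (h0 : y r = y' r) : EqOn y y' J := by
  have : PreconnectedSpace J := isPreconnected_iff_preconnectedSpace.1 hJ.isPreconnected
  have hclosed : IsClosed {t : J | y t = y' t} := isClosed_eq
    (continuousOn_iff_continuous_domRestrict.1 hy.holder.1)
    (continuousOn_iff_continuous_domRestrict.1 hy'.holder.1)
  have hopen : IsOpen {t : J | y t = y' t} := by
    rw [isOpen_iff_mem_nhds]
    intro t ht
    have := hy.eventually_eq hα hπ hη hJ hx hy' t.2 ht
    exact preimage_coe_mem_nhds_subtype.2 this
  have huniv := IsClopen.eq_univ ⟨hclosed, hopen⟩ ⟨⟨r, hr⟩, h0⟩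
  intro t ht
  exact (huniv ▸ mem_univ (⟨t, ht⟩ : J) : (⟨t, ht⟩ : J) ∈ {t : J | y t = y' t})

/-- Lifts exist on a time interval that is uniform in the initial time and the initial point. -/
theorem exists_local_youngLift (hα : 1 / 2 < α) (hπ : IsPrincipalBundle EM EG EP G π)
    (hη : IsConnectionForm η) {T : ℝ} (hx : IsHolderPath EM α (Icc 0 T) x) (hr : r ∈ Icc 0 T)
    {p : P} (hp : π p = x r) :
    ∃ ε > 0, ∃ W ∈ 𝓝 p, ∀ s ∈ Icc 0 T, |s - r| < ε → ∀ q ∈ W, π q = x s →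
      ∃ y : ℝ → P, y s = q ∧ IsYoungLift π η α x (Icc s (min T (r + ε))) y := by
  obtain ⟨h, k, hh, hk, hfr⟩ := exists_horizontalFrame hπ hη p
  set e := chartAt EP p with he
  set c := chartAt EM (π p) with hcdef
  have hatl : e ∈ IsManifold.maximalAtlas 𝓘(ℝ, EP) ∞ P := IsManifold.chart_mem_maximalAtlas p
  have hatlM : c ∈ IsManifold.maximalAtlas 𝓘(ℝ, EM) ∞ M := IsManifold.chart_mem_maximalAtlas (π p)
  have hpe : p ∈ e.source := mem_chart_source EP p
  have hxc : x r ∈ c.source := hp ▸ mem_chart_source EM (π p)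
  have hX := hx.nearO hatlM hr hxc
  have hform := contDiffAt_formInChart (F := EG) hη.smooth hatl (e.map_source hpe)
  -- inside `U` the frame exists and the coefficients are bounded
  have hU : ∀ᶠ z in 𝓝 (e p), IsHorizontalFrame π η p h k z ∧
      ‖formInChart (F := EG) e η z‖ ≤ ‖formInChart (F := EG) e η (e p)‖ + 1 ∧
      ‖fderiv ℝ (projInChart (EM := EM) (EP := EP) π p) z‖
        ≤ ‖fderiv ℝ (projInChart (EM := EM) (EP := EP) π p) (e p)‖ + 1 := by
    have hD : ContinuousAt (fderiv ℝ (projInChart (EM := EM) (EP := EP) π p)) (e p) :=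
      (hfr.self_of_nhds.contDiffAt_proj.fderiv_right (m := ∞) (by simp)).continuousAt
    exact hfr.and (((hform.continuousAt.norm.eventually_lt_const (lt_add_one _)).mono
      fun _ h ↦ h.le).and ((hD.norm.eventually_lt_const (lt_add_one _)).mono fun _ h ↦ h.le))
  obtain ⟨ε₀, hε₀, hsol⟩ := exists_local_young_solution hα (hh.of_le two_le_infty) hX hU
  obtain ⟨δ, hδ, hball⟩ := Metric.eventually_nhds_iff_ball.1 (eventually_nhdsWithin_iff.1
    (eventually_mem_source (hx.1 r hr) hxc))
  obtain ⟨ε, hε, hlt⟩ := exists_between (lt_min hε₀ hδ)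
  simp only [lt_min_iff] at hlt
  obtain ⟨W, hW, hsolW⟩ := hsol ε hε hlt.1
  refine ⟨ε, hε, e.source ∩ e ⁻¹' W, inter_mem (e.open_source.mem_nhds hpe)
    ((e.continuousAt hpe).preimage_mem_nhds hW), fun s hs hsr q hq hqx ↦ ?_⟩
  obtain ⟨Y, hY0, hYU, hY⟩ := hsolW s hs hsr (e q) hq.2
  set I := Icc s (min T (r + ε)) with hI
  have hIT : I ⊆ Icc 0 T := Icc_subset_Icc hs.1 (min_le_left _ _)
  have hsI : s ∈ I := ⟨le_rfl, le_min hs.2 (by linarith [(abs_lt.1 hsr).2])⟩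
  have hxI : ∀ t ∈ I, x t ∈ c.source := fun t ht ↦ by
    refine hball t ?_ (hIT ht)
    rw [Metric.mem_ball, Real.dist_eq, abs_lt]
    exact ⟨by linarith [ht.1, (abs_lt.1 hsr).1],
      by linarith [ht.2.trans (min_le_right T (r + ε))]⟩
  have hXI : ∀ t ∈ I, NearO α (𝓝[I] t) (fun s t ↦ c (x t) - c (x s)) := fun t ht ↦
    (hx.nearO hatlM (hIT ht) (hxI t ht)).mono (nhdsWithin_mono t hIT)
  have hYc : ∀ t ∈ I, ContinuousWithinAt Y I t := fun t ht ↦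
    (hY t ht).1.continuousWithinAt (by linarith) ht
  have hfrI : ∀ t ∈ I, IsHorizontalFrame π η p h k (Y t) := fun t ht ↦ (hYU t ht).1
  -- the projection of the solution has the same increments as `x` up to order `2α`
  have hdiff : ∀ t ∈ I, NearO (2 * α) (𝓝[I] t)
      (fun s t ↦ (projInChart π p (Y t) - c (x t)) - (projInChart π p (Y s) - c (x s))) := by
    intro t ht
    have h1 := nearO_taylor (hY t ht).1 (hYc t ht)
      ((hfrI t ht).contDiffAt_proj.of_le two_le_infty)
    have h2 := (hY t ht).2.clm_apply (A := fun s ↦ fderiv ℝ (projInChart (EM := EM) π p) (Y s))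
      (eventually_nhdsWithin_of_forall fun s hs ↦ (hYU s hs).2.2)
    refine (h1.add h2).congr (self_mem_nhdsWithin (a := t) (s := I)) fun s t hs ht ↦ ?_
    rw [map_sub _ (Y t - Y s) (h _ _), (hfrI s hs).proj_lift]
    abel
  have hpr : ∀ t ∈ I, π (e.symm (Y t)) = x t := by
    intro t ht
    have h1 := eq_of_nearO ordConnected_Icc (by linarith) hdiff hsI ht
    have h2 : projInChart π p (Y s) - c (x s) = 0 := by
      simp only [projInChart, ← he, ← hcdef]
      rw [hY0, e.left_inv hq.1, hqx, sub_self]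
    rw [h2, sub_eq_zero] at h1
    exact c.injOn (hfrI t ht).mem_source (hxI t ht) h1
  have hsrc : ∀ t ∈ I, e.symm (Y t) ∈ e.source := fun t ht ↦ e.map_target (hfrI t ht).mem_target
  have hright : ∀ t ∈ I, e (e.symm (Y t)) = Y t := fun t ht ↦ e.right_inv (hfrI t ht).mem_target
  have hcont : ContinuousOn (fun t ↦ e.symm (Y t)) I := fun t ht ↦
    (e.continuousAt_symm (hfrI t ht).mem_target).comp_continuousWithinAt (hYc t ht)
  have hYe : ∀ t ∈ I, NearO α (𝓝[I] t) (fun s t ↦ e (e.symm (Y t)) - e (e.symm (Y s))) :=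
    fun t ht ↦ (hY t ht).1.congr (self_mem_nhdsWithin (a := t) (s := I)) fun s t hs ht ↦ by
      rw [hright s hs, hright t ht]
  refine ⟨fun t ↦ e.symm (Y t), by simp only [hY0, e.left_inv hq.1],
    isHolderPath_iff.2 ⟨hcont, fun t ht ↦ nearO_chart_change hatl
      (IsManifold.chart_mem_maximalAtlas _) (hcont t ht) (hsrc t ht) (mem_chart_source EP _)
      (hYe t ht)⟩, hpr, fun t ht ↦ isPrimitiveAt_of_chart (F := EG) hη.smooth hatl (hcont t ht)
      (hsrc t ht) (hYe t ht) ?_⟩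
  have h1 := (hY t ht).2.clm_apply (A := fun s ↦ formInChart (F := EG) e η (Y s))
    (eventually_nhdsWithin_of_forall fun s hs ↦ (hYU s hs).2.1)
  have hneg : NearO (2 * α) (𝓝[I] t) (fun _ _ ↦ (0 : EG)) := Asymptotics.isBigO_zero _ _
  refine (hneg.sub h1).congr (self_mem_nhdsWithin (a := t) (s := I)) fun s t hs ht ↦ ?_
  rw [hright s hs, hright t ht, map_sub _ (Y t - Y s) (h _ _), (hfrI s hs).form_lift]
  simp

end Lift

/-! ### The maximal lift -/

section Global

variable {EM : Type*} [NormedAddCommGroup EM] [NormedSpace ℝ EM] [FiniteDimensional ℝ EM]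
  {M : Type*} [TopologicalSpace M] [ChartedSpace EM M] [IsManifold 𝓘(ℝ, EM) ∞ M]
  {EG : Type*} [NormedAddCommGroup EG] [NormedSpace ℝ EG] [FiniteDimensional ℝ EG]
  {G : Type*} [TopologicalSpace G] [ChartedSpace EG G] [Group G] [LieGroup 𝓘(ℝ, EG) ∞ G]
  {EP : Type*} [NormedAddCommGroup EP] [NormedSpace ℝ EP] [FiniteDimensional ℝ EP]
  {P : Type*} [TopologicalSpace P] [ChartedSpace EP P] [IsManifold 𝓘(ℝ, EP) ∞ P] [T2Space P]
  [MulAction Gᵐᵒᵖ P] {π : P → M}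
  {η : ∀ p : P, TangentSpace 𝓘(ℝ, EP) p →L[ℝ] GroupLieAlgebra 𝓘(ℝ, EG) G}
  {α : ℝ} {x : ℝ → M} {T : ℝ}

/-- A lift on `[0, τ)` that accumulates at a point of `P` as `t → τ` extends beyond `τ`: near the
accumulation point, lifts exist on a uniform time interval. -/
theorem IsYoungLift.exists_extension [T2Space M] (hα : 1 / 2 < α)
    (hπ : IsPrincipalBundle EM EG EP G π) (hη : IsConnectionForm η)
    (hx : IsHolderPath EM α (Icc 0 T) x) {τ : ℝ} (hτ : 0 < τ) (hτT : τ ≤ T) {y : ℝ → P}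
    (hy : IsYoungLift π η α x (Ico 0 τ) y) {p : P} (hp : MapClusterPt p (𝓝[<] τ) y) :
    ∃ ε > 0, ∃ z : ℝ → P, z 0 = y 0 ∧ IsYoungLift π η α x (Icc 0 (min T (τ + ε))) z := by
  have hτmem : τ ∈ Icc 0 T := ⟨hτ.le, hτT⟩
  have hIco : Ico 0 τ ∈ 𝓝[<] τ := Ico_mem_nhdsLT hτ
  have hpx : π p = x τ := by
    have h1 : MapClusterPt (π p) (𝓝[<] τ) (π ∘ y) :=
      hp.continuousAt_comp hπ.contMDiff_proj.continuous.continuousAt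
    have h2 : Tendsto (π ∘ y) (𝓝[<] τ) (𝓝 (x τ)) := by
      have h3 : Tendsto x (𝓝[<] τ) (𝓝 (x τ)) :=
        (hx.1 τ hτmem).mono_left (nhdsWithin_le_of_mem
          (mem_of_superset hIco fun t ht ↦ ⟨ht.1, ht.2.le.trans hτT⟩))
      refine h3.congr' ?_
      filter_upwards [hIco] with t ht using (hy.proj t ht).symm
    exact eq_of_nhds_neBot ((ClusterPt.mono h1 h2).neBot)
  obtain ⟨ε, hε, W, hW, hext⟩ := exists_local_youngLift hα hπ hη hx hτmem hpx
  obtain ⟨s, hsW, ⟨hs0, hsτ⟩, hsε⟩ := ((mapClusterPt_iff_frequently.1 hp W hW).and_eventually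
    ((show ∀ᶠ t in 𝓝[<] τ, t ∈ Ico 0 τ from hIco).and (mem_nhdsWithin_of_mem_nhds
      (Ioi_mem_nhds (show τ - ε < τ by linarith))))).exists
  obtain ⟨z, hzs, hz⟩ := hext s ⟨hs0, hsτ.le.trans hτT⟩
    (by rw [abs_sub_comm, abs_of_pos (by linarith)]; linarith) (y s) hsW (hy.proj s ⟨hs0, hsτ⟩)
  set b := min T (τ + ε) with hb
  have hτb : τ ≤ b := le_min hτT (by linarith)
  have heq : EqOn y z (Ico s τ) :=
    (hy.mono (Ico_subset_Ico_left hs0)).eqOn hα hπ hη ordConnected_Ico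
      (hx.mono fun t ht ↦ ⟨hs0.trans ht.1, ht.2.le.trans hτT⟩)
      (hz.mono fun t ht ↦ ⟨ht.1, ht.2.le.trans hτb⟩) (left_mem_Ico.2 hsτ) hzs.symm
  refine ⟨ε, hε, fun t ↦ if t < τ then y t else z t, if_pos hτ, IsYoungLift.of_local fun r hr ↦ ?_⟩
  rcases lt_or_ge r τ with hrτ | hrτ
  · refine ⟨Ico 0 τ, y, hy, ⟨hr.1, hrτ⟩, ?_, ?_⟩
    · filter_upwards [self_mem_nhdsWithin, mem_nhdsWithin_of_mem_nhds (Iio_mem_nhds hrτ)]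
        with t ht ht' using ⟨ht.1, ht'⟩
    · filter_upwards [mem_nhdsWithin_of_mem_nhds (Iio_mem_nhds hrτ)] with t ht using (if_pos ht).symm
  · have hsr : s < r := hsτ.trans_le hrτ
    refine ⟨Icc s b, z, hz, ⟨hsr.le, hr.2⟩, ?_, ?_⟩
    · filter_upwards [self_mem_nhdsWithin, mem_nhdsWithin_of_mem_nhds (Ioi_mem_nhds hsr)]
        with t ht ht' using ⟨le_of_lt ht', ht.2⟩
    · filter_upwards [mem_nhdsWithin_of_mem_nhds (Ioi_mem_nhds hsr)] with t ht
      by_cases htτ : t < τ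
      · rw [if_pos htτ]
        exact (heq ⟨le_of_lt ht, htτ⟩).symm
      · rw [if_neg htτ]

/-- By uniqueness, the lifts on the intervals `[0, b]` glue to a lift on the set of all times up to
which a lift exists. -/
theorem exists_maximal_youngLift (hα : 1 / 2 < α) (hπ : IsPrincipalBundle EM EG EP G π)
    (hη : IsConnectionForm η) (hx : IsHolderPath EM α (Icc 0 T) x) (u : P)
    (h0 : 0 ∈ liftTimes π η α x T u) : ∃ y : ℝ → P, y 0 = u ∧
      IsYoungLift π η α x (liftTimes π η α x T u) y ∧
      ∀ b ∈ Icc 0 T, ∀ y', IsYoungLift π η α x (Icc 0 b) y' → y' 0 = u → EqOn y' y (Icc 0 b) := by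
  classical
  set S := liftTimes π η α x T u with hS
  have hex : ∀ b, ∃ y : ℝ → P, b ∈ S → IsYoungLift π η α x (Icc 0 b) y ∧ y 0 = u := fun b ↦ by
    by_cases hb : b ∈ S
    · obtain ⟨-, y, hy⟩ := hb
      exact ⟨y, fun _ ↦ hy⟩
    · exact ⟨fun _ ↦ u, fun h ↦ absurd h hb⟩
  choose Y hY using hex
  have hagree : ∀ b ∈ Icc 0 T, ∀ y', IsYoungLift π η α x (Icc 0 b) y' → y' 0 = u →
      EqOn y' (fun t ↦ Y t t) (Icc 0 b) := by
    intro b hb y' hy' hy0 t ht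
    have htS : t ∈ S := ⟨⟨ht.1, ht.2.trans hb.2⟩, y', hy'.mono (Icc_subset_Icc_right ht.2), hy0⟩
    exact (hy'.mono (Icc_subset_Icc_right ht.2)).eqOn hα hπ hη ordConnected_Icc
      (hx.mono (Icc_subset_Icc_right htS.1.2)) (hY t htS).1 (left_mem_Icc.2 ht.1)
      (hy0.trans (hY t htS).2.symm) (right_mem_Icc.2 ht.1)
  refine ⟨fun t ↦ Y t t, (hY 0 h0).2, IsYoungLift.of_local fun r hr ↦ ?_, hagree⟩
  obtain ⟨b, hb, hrb, hmem⟩ : ∃ b ∈ S, r ≤ b ∧ Icc 0 b ∈ 𝓝[S] r := by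
    by_cases hb : ∃ b ∈ S, r < b
    · obtain ⟨b, hb, hrb⟩ := hb
      refine ⟨b, hb, hrb.le, ?_⟩
      filter_upwards [self_mem_nhdsWithin, mem_nhdsWithin_of_mem_nhds (Iio_mem_nhds hrb)]
        with s hs hs' using ⟨hs.1.1, le_of_lt hs'⟩
    · push Not at hb
      refine ⟨r, hr, le_rfl, ?_⟩
      filter_upwards [self_mem_nhdsWithin] with s hs using ⟨hs.1.1, hb s hs⟩
  refine ⟨Icc 0 b, Y b, (hY b hb).1, ⟨hr.1.1, hrb⟩, hmem, ?_⟩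
  filter_upwards [hmem] with t ht using hagree b hb.1 (Y b) (hY b hb).1 (hY b hb).2 ht

end Global

end YoungLift

theorem mainTheorem4
    {EM : Type*} [NormedAddCommGroup EM] [NormedSpace ℝ EM] [FiniteDimensional ℝ EM]
    {M : Type*} [TopologicalSpace M] [ChartedSpace EM M] [IsManifold 𝓘(ℝ, EM) ∞ M]
    [T2Space M] [ParacompactSpace M] [ConnectedSpace M]
    {EG : Type*} [NormedAddCommGroup EG] [NormedSpace ℝ EG] [FiniteDimensional ℝ EG]
    {G : Type*} [TopologicalSpace G] [ChartedSpace EG G] [Group G] [LieGroup 𝓘(ℝ, EG) ∞ G]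
    {EP : Type*} [NormedAddCommGroup EP] [NormedSpace ℝ EP] [FiniteDimensional ℝ EP]
    {P : Type*} [TopologicalSpace P] [ChartedSpace EP P] [IsManifold 𝓘(ℝ, EP) ∞ P] [T2Space P]
    [MulAction Gᵐᵒᵖ P]
    (π : P → M) (hπ : YoungLift.IsPrincipalBundle EM EG EP G π)
    (η : ∀ p : P, TangentSpace 𝓘(ℝ, EP) p →L[ℝ] GroupLieAlgebra 𝓘(ℝ, EG) G)
    (hη : YoungLift.IsConnectionForm η)
    (α : ℝ) (hα : 1 / 2 < α) (hα' : α < 1) (T : ℝ) (hT : 0 < T)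
    (x : ℝ → M) (hx : YoungLift.IsHolderPath EM α (Icc 0 T) x)
    (u : P) (hu : π u = x 0) :
    ∃ (J : Set ℝ) (y : ℝ → P),
      YoungLift.IsHorizontalLift π η α x u J y ∧
      (J = Icc 0 T ∨
        ∃ τ : ℝ, 0 < τ ∧ τ ≤ T ∧ J = Ico 0 τ ∧
          ∀ K : Set P, IsCompact K → ∀ᶠ t in 𝓝[<] τ, y t ∉ K) ∧
      ∀ (J' : Set ℝ) (y' : ℝ → P), J'.OrdConnected → 0 ∈ J' → J' ⊆ Icc 0 T →
        YoungLift.IsHorizontalLift π η α x u J' y' → J' ⊆ J ∧ EqOn y' y J' := by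
  set S := YoungLift.liftTimes π η α x T u with hS
  -- a lift exists for a positive time
  obtain ⟨b₀, hb₀, hb₀S⟩ : ∃ b > 0, b ∈ S := by
    obtain ⟨ε, hε, W, hW, h⟩ := YoungLift.exists_local_youngLift hα hπ hη hx (r := 0)
      (left_mem_Icc.2 hT.le) hu
    obtain ⟨y, hy0, hy⟩ := h 0 (left_mem_Icc.2 hT.le) (by simpa using hε) u (mem_of_mem_nhds hW) hu
    have hpos : 0 < min T (0 + ε) := lt_min hT (by linarith)
    exact ⟨min T (0 + ε), hpos, ⟨hpos.le, min_le_left _ _⟩, y, hy, hy0⟩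
  have hord : S.OrdConnected := YoungLift.ordConnected_liftTimes
  have hdown : ∀ b ∈ S, ∀ t, 0 ≤ t → t ≤ b → t ∈ S := by
    rintro b ⟨hb, y, hy, hy0⟩ t ht htb
    exact ⟨⟨ht, htb.trans hb.2⟩, y, hy.mono (Icc_subset_Icc_right htb), hy0⟩
  have h0S : 0 ∈ S := hdown b₀ hb₀S 0 le_rfl hb₀.le
  obtain ⟨y, hy0, hy, huniq⟩ := YoungLift.exists_maximal_youngLift hα hπ hη hx u h0S
  have hbdd : BddAbove S := ⟨T, fun b hb ↦ hb.1.2⟩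
  set τ := sSup S with hτdef
  have hτpos : 0 < τ := hb₀.trans_le (le_csSup hbdd hb₀S)
  have hτT : τ ≤ T := csSup_le ⟨0, h0S⟩ fun b hb ↦ hb.1.2
  have hlt : ∀ t, 0 ≤ t → t < τ → t ∈ S := by
    intro t ht htτ
    obtain ⟨b, hb, htb⟩ := exists_lt_of_lt_csSup ⟨0, h0S⟩ htτ
    exact hdown b hb t ht htb.le
  have hyIco : YoungLift.IsYoungLift π η α x (Ico 0 τ) y :=
    hy.mono fun t ht ↦ hlt t ht.1 ht.2
  -- an accumulation point of the lift at `τ` prolongs it up to the end of the time interval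
  have hcluster : ∀ p, MapClusterPt p (𝓝[<] τ) y → τ = T ∧ T ∈ S := by
    intro p hp
    obtain ⟨ε, hε, z, hz0, hz⟩ := hyIco.exists_extension hα hπ hη hx hτpos hτT hp
    have hmem : min T (τ + ε) ∈ S :=
      ⟨⟨le_min hT.le (by linarith), min_le_left _ _⟩, z, hz, hz0.trans hy0⟩
    have hle := le_csSup hbdd hmem
    rcases min_choice T (τ + ε) with h | h
    · rw [h] at hle hmem
      exact ⟨le_antisymm hτT hle, hmem⟩
    · rw [h] at hle
      linarith
  refine ⟨S, y, (YoungLift.isHorizontalLift_iff hα hη hord h0S fun t ht ↦ ht.1.1).2 ⟨hy, hy0⟩,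
    ?_, fun J' y' hJ' h0' hJT hy' ↦ ?_⟩
  · by_cases hTS : T ∈ S
    · exact Or.inl (Subset.antisymm (fun t ht ↦ ht.1) fun t ht ↦ hdown T hTS t ht.1 ht.2)
    · have hτS : τ ∉ S := fun hτS ↦ by
        have hc : Tendsto y (𝓝[<] τ) (𝓝 (y τ)) := (hy.holder.1 τ hτS).mono_left
          (nhdsWithin_le_of_mem (mem_of_superset (Ico_mem_nhdsLT hτpos) fun t ht ↦
            hlt t ht.1 ht.2))
        exact hTS (hcluster _ hc.mapClusterPt).2
      refine Or.inr ⟨τ, hτpos, hτT, Subset.antisymm (fun t ht ↦ ⟨ht.1.1, lt_of_le_of_ne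
        (le_csSup hbdd ht) fun h ↦ hτS (h ▸ ht)⟩) fun t ht ↦ hlt t ht.1 ht.2, fun K hK ↦ ?_⟩
      by_contra hfr
      rw [not_eventually] at hfr
      obtain ⟨p, -, hp⟩ := hK.exists_mapClusterPt_of_frequently
        (hfr.mono fun t ht ↦ not_not.1 ht)
      exact hTS (hcluster p hp).2
  · have hy'' := (YoungLift.isHorizontalLift_iff hα hη hJ' h0' fun t ht ↦ (hJT ht).1).1 hy'
    have hsub : ∀ t ∈ J', YoungLift.IsYoungLift π η α x (Icc 0 t) y' := fun t ht ↦
      hy''.1.mono (hJ'.out h0' ht)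
    exact ⟨fun t ht ↦ ⟨hJT ht, y', hsub t ht, hy''.2⟩, fun t ht ↦
      huniq t (hJT ht) y' (hsub t ht) hy''.2 (right_mem_Icc.2 (hJT ht).1)⟩
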